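/- Let $\mathfrak g$ be a finite-dimensional complex simple Lie algebra that is not isomorphic to $\mathfrak{sl}(2,\mathbb C)$, with Cartan subalgebra $\mathfrak t$ and root set $\Delta\subset\mathfrak t^*$; put $\Delta_0=\Delta\cup\{0\}$. Let $V$ be a finite-dimensional complex vector space with a non-degenerate symmetric bilinear form $H$, and let $\kappa:\mathfrak g\to\mathfrak{so}(V,H)$ be an irreducible representation of real type, i.e. $V$, regarded as a real module over a compact real form of $\mathfrak g$, is reducible. Let $\Omega\subset\mathfrak t^*$ be the set of weights of $\kappa$; the extremal weights are the images of the highest weight under the Weyl group. Suppose that $\kappa$ admits a planar spanning triple $(\Lambda,-\Lambda,U)$: $\Lambda$ and $-\Lambda$ are extremal weights, $U\subset\mathfrak t^*$ is an affine hyperplane that contains every extremal weight different from $\pm\Lambda$, and $$\Omega\subset\{\Lambda+\beta\mid\beta\in\Delta_0\}\cup U\cup\{-\Lambda+\beta\mid\beta\in\Delta_0\}.$$ Suppose also that there are no root $\alpha\in\Delta$ and no scalar $a\in\mathbb C$ with $\Lambda=a\alpha$. Then there is an $n\ge 3$ such that $\mathfrak g$ is of type $D_n$ and, for every fundamental system $(\pi_1,\dots,\pi_n)$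 of $\Delta$ in the standard numbering of type $D_n$ (the Dynkin diagram is the chain $\pi_1,\dots,\pi_{n-2}$ with $\pi_{n-1}$ and $\pi_n$ both joined to $\pi_{n-2}$; thus $D_3=A_3$ with $\pi_1$ the middle node), $\kappa$ is congruent to an irreducible representation $\mathfrak g\to\mathfrak{so}(V,H)$ of highest weight $\omega_1$ or $2\omega_1$, where $\omega_1$ is the first fundamental weight. Here two representations $\kappa_1,\kappa_2:\mathfrak g\to\mathfrak{so}(V,H)$ are congruent if there are $\varphi\in O(V,H)$ and an automorphism $\sigma$ of $\mathfrak g$ with $\kappa_1(\sigma(x))=\varphi\,\kappa_2(x)\,\varphi^{-1}$ for all $x\in\mathfrak g$. -/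

import Mathlib

open Module

attribute [local instance 100] LieRing.ofAssociativeRing

namespace OrthRep

variable {𝔤 : Type*} [LieRing 𝔤] [LieAlgebra ℂ 𝔤]
variable {V : Type*} [AddCommGroup V] [Module ℂ V]

/-- The Lie algebra `𝔰𝔬(V, B)` of endomorphisms of `V` that are skew for the bilinear form `B`. -/
abbrev so (B : LinearMap.BilinForm ℂ V) : LieSubalgebra ℂ (Module.End ℂ V) :=
  skewAdjointLieSubalgebra B

variable {B : LinearMap.BilinForm ℂ V}

/-- Irreducibility of a representation `κ : 𝔤 → 𝔰𝔬(V, B)`: `V ≠ 0`, and the only invariant complex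
subspaces are `0` and `V`. -/
def IsIrreducible (κ : 𝔤 →ₗ⁅ℂ⁆ so B) : Prop :=
  Nontrivial V ∧
    ∀ W : Submodule ℂ V, (∀ x : 𝔤, ∀ v ∈ W, (κ x : Module.End ℂ V) v ∈ W) → W = ⊥ ∨ W = ⊤

/-- A compact real form of the complex Lie algebra `𝔤`: a real subspace `𝔤₀`, closed under the
bracket, with `𝔤 = 𝔤₀ ⊕ i𝔤₀`, on which the Killing form is negative definite.
(On a real form the Killing form of `𝔤` is real and agrees with the Killing form of `𝔤₀`.) -/
structure IsCompactRealForm (𝔤₀ : Submodule ℝ 𝔤) : Prop where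
  lie_mem : ∀ x ∈ 𝔤₀, ∀ y ∈ 𝔤₀, ⁅x, y⁆ ∈ 𝔤₀
  existsUnique_decomp : ∀ z : 𝔤, ∃! p : 𝔤₀ × 𝔤₀, z = (p.1 : 𝔤) + Complex.I • (p.2 : 𝔤)
  killing_neg : ∀ x ∈ 𝔤₀, x ≠ 0 → (killingForm ℂ 𝔤 x x).re < 0

/-- The (irreducible) complex representation `κ` is of real type: for a compact real form `𝔤₀` of
`𝔤`, the space `V`, viewed as a real `𝔤₀`-module, is reducible. -/
def IsOfRealType (κ : 𝔤 →ₗ⁅ℂ⁆ so B) : Prop :=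
  ∃ 𝔤₀ : Submodule ℝ 𝔤, IsCompactRealForm 𝔤₀ ∧
    ∃ W : Submodule ℝ V, W ≠ ⊥ ∧ W ≠ ⊤ ∧
      ∀ x ∈ 𝔤₀, ∀ v ∈ W, (κ x : Module.End ℂ V) v ∈ W

/-- Congruence of two orthogonal representations `κ₁, κ₂ : 𝔤 → 𝔰𝔬(V, B)`: for some `φ ∈ O(V, B)`
and some automorphism `σ` of `𝔤` one has `κ₁ ∘ σ = Ad_φ ∘ κ₂`, that is
`κ₁ (σ x) = φ ∘ κ₂ x ∘ φ⁻¹` for all `x`. -/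
def Congruent (κ₁ κ₂ : 𝔤 →ₗ⁅ℂ⁆ so B) : Prop :=
  ∃ (σ : 𝔤 ≃ₗ⁅ℂ⁆ 𝔤) (φ : V ≃ₗ[ℂ] V),
    (∀ v w : V, B (φ v) (φ w) = B v w) ∧
    ∀ (x : 𝔤) (v : V), (κ₁ (σ x) : Module.End ℂ V) (φ v) = φ ((κ₂ x : Module.End ℂ V) v)

/-- The set `Ω ⊆ 𝔱*` of weights of `κ` with respect to `𝔱`. -/
def weights (κ : 𝔤 →ₗ⁅ℂ⁆ so B) (𝔱 : LieSubalgebra ℂ 𝔤) : Set (Dual ℂ 𝔱) :=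
  {μ | ∃ v : V, v ≠ 0 ∧ ∀ t : 𝔱, (κ (t : 𝔤) : Module.End ℂ V) v = μ t • v}

/-- An affine hyperplane. -/
def IsAffineHyperplane {E : Type*} [AddCommGroup E] [Module ℂ E] (U : AffineSubspace ℂ E) : Prop :=
  (U : Set E).Nonempty ∧ IsCoatom U.direction

section Roots

variable [FiniteDimensional ℂ 𝔤] [LieAlgebra.IsKilling ℂ 𝔤]
variable (𝔱 : LieSubalgebra ℂ 𝔤) [𝔱.IsCartanSubalgebra]

/-- The root system of `𝔤` with respect to the Cartan subalgebra `𝔱`. -/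
noncomputable abbrev rootSys : RootPairing 𝔱.root ℂ (Dual ℂ 𝔱) 𝔱 :=
  LieAlgebra.IsKilling.rootSystem 𝔱

/-- The set `Δ ⊆ 𝔱*` of roots. -/
def roots : Set (Dual ℂ 𝔱) := Set.range (rootSys 𝔱).root

/-- `Δ₀ = Δ ∪ {0}`. -/
def rootsZero : Set (Dual ℂ 𝔱) := roots 𝔱 ∪ {0}

variable {𝔱}

/-- `l` is the highest weight of `κ` with respect to the fundamental system `b`: it is a weight, and
every weight arises from it by subtracting a sum of simple roots. -/
def IsHighestWeight (κ : 𝔤 →ₗ⁅ℂ⁆ so B) (b : (rootSys 𝔱).Base) (l : Dual ℂ 𝔱) : Prop :=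
  l ∈ weights κ 𝔱 ∧
    ∀ μ ∈ weights κ 𝔱, l - μ ∈ AddSubmonoid.closure ((rootSys 𝔱).root '' b.support)

/-- Extremal weights: the images of the highest weight under the Weyl group. -/
def IsExtremalWeight (κ : 𝔤 →ₗ⁅ℂ⁆ so B) (μ : Dual ℂ 𝔱) : Prop :=
  ∃ (b : (rootSys 𝔱).Base) (l : Dual ℂ 𝔱), IsHighestWeight κ b l ∧
    ∃ w : (rootSys 𝔱).weylGroup, μ = w • l

/-- `(μ₁, μ₂, U)` is a planar spanning triple. -/
structure IsPlanarSpanningTriple (κ : 𝔤 →ₗ⁅ℂ⁆ so B) (μ₁ μ₂ : Dual ℂ 𝔱)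
    (U : AffineSubspace ℂ (Dual ℂ 𝔱)) : Prop where
  extremal_left : IsExtremalWeight κ μ₁
  extremal_right : IsExtremalWeight κ μ₂
  hyperplane : IsAffineHyperplane U
  extremal_mem : ∀ μ, IsExtremalWeight κ μ → μ ≠ μ₁ → μ ≠ μ₂ → μ ∈ U
  weights_subset : weights κ 𝔱 ⊆
    {μ | ∃ β ∈ rootsZero 𝔱, μ = μ₁ + β} ∪ (U : Set (Dual ℂ 𝔱)) ∪
      {μ | ∃ β ∈ rootsZero 𝔱, μ = μ₂ + β}

/-- `e` numbers the simple roots `π₁, …, πₙ` of the fundamental system `b` (as `e 0, …, e (n - 1)`)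
in such a way that the Cartan matrix is the standard one of type `Dₙ`: the Dynkin diagram is the
chain `π₁ — π₂ — ⋯ — πₙ₋₂`, with `πₙ₋₁` and `πₙ` both attached to `πₙ₋₂`. -/
def IsNumberingD (b : (rootSys 𝔱).Base) (n : ℕ) (e : Fin n ≃ b.support) : Prop :=
  ∀ i j : Fin n, b.cartanMatrix (e i) (e j) = CartanMatrix.D n i j

/-- `ω` is the fundamental weight dual to the `i`-th simple coroot. -/
def IsFundamentalWeight (b : (rootSys 𝔱).Base) {n : ℕ} (e : Fin n ≃ b.support) (i : Fin n)
    (ω : Dual ℂ 𝔱) : Prop :=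
  ∀ j : Fin n, ω ((rootSys 𝔱).coroot (e j)) = if j = i then 1 else 0

end Roots

end OrthRep

set_option linter.unusedSectionVars false

/-! Let $S$ be the orbit of `Λ` under the Weyl group and $-1$. All members of $S$ are extremal, so
`U` contains every one except $\pm\Lambda$. As `Λ` is not parallel to a root, some reflection sends
it to a $w\ne\pm\Lambda$; both $\pm w$ lie in `U`, hence $0\in U$, and irreducibility forces
$\Lambda\notin U$. So some functional is $1$ at `Λ` and $0$ on `U`
(`exists_dual_of_signedOrbit_subset`). Transported by the Weyl group, it shows
$S=\{\pm\varepsilon_1,\dots,\pm\varepsilon_n\}$ with $(\varepsilon_p)$ a basis of $\mathfrak t^*$.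

A reflection taking one member of $S$ to another on a different line has root parallel to their
difference and fixes the remaining lines pointwise (`coroot'_eq_zero`). Conjugating such reflections
makes the relation `ReflectsTo` transitive and keeps the coroot value $k$ (`ReflectsTo.trans`).
Irreducibility then joins any two members on different lines: `exists_reflectsTo_neg` rules out the
type $A$ pattern, `exists_third` rules out $D_2$. Thus the roots are exactly
$k^{-1}(\pm\varepsilon_p\pm\varepsilon_q)$, $p\ne q$, which is type $D_n$ with $n\ge3$.

The highest weight lies in $S$; after sorting the $\varepsilon_p$ by height, dominance makes it
$\varepsilon_1=k\omega_1$. If $k\ge3$, an interior point of a root string from it is a weight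
outside `U` that differs from neither of $\pm\Lambda$ by an element of $\Delta_0$
(`natCast_scale_le_two`). Any other fundamental system numbered as $D_n$ has the same Cartan matrix,
so an automorphism of $\mathfrak g$ matches the two, and composing `κ` with it gives the required
representation. -/

/-! ### Automorphisms of a simple Lie algebra from equal Cartan matrices. -/

theorem LieEquiv.apply_symm_of_proj {K L₁ L₂ : Type*} [CommRing K] [LieRing L₁] [LieRing L₂]
    [LieAlgebra K L₁] [LieAlgebra K L₂] {D : LieSubalgebra K (L₁ × L₂)} (σ : D ≃ₗ⁅K⁆ L₁)
    (τ : D ≃ₗ⁅K⁆ L₂) (hσ : ∀ x, σ x = (x : L₁ × L₂).1) (hτ : ∀ x, τ x = (x : L₁ × L₂).2)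
    {y : L₁ × L₂} (hy : y ∈ D) : τ (σ.symm y.1) = y.2 := by
  have : σ.symm y.1 = ⟨y, hy⟩ := by rw [LieEquiv.symm_apply_eq, hσ]
  rw [this, hτ]

/-- The isomorphism has as its graph the subalgebra of the product generated by pairs of matching
generators, so its values on generators can be read off. -/
theorem LieAlgebra.Basis.equivOfReindex_apply_h {ι₁ ι₂ L₁ L₂ : Type*} [Finite ι₁] [Finite ι₂]
    (eι : ι₁ ≃ ι₂) [LieRing L₁] [LieRing L₂] {K : Type*} [Field K] [CharZero K]
    [LieAlgebra K L₁] [FiniteDimensional K L₁] {H₁ : LieSubalgebra K L₁}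
    (b₁ : LieAlgebra.Basis ι₁ H₁)
    [LieAlgebra K L₂] [FiniteDimensional K L₂] {H₂ : LieSubalgebra K L₂}
    (b₂ : LieAlgebra.Basis ι₂ H₂) (hA : b₁.A.reindex eι eι = b₂.A)
    [LieAlgebra.IsSimple K L₁] [LieAlgebra.IsSimple K L₂] (i : ι₁) :
    equivOfReindex eι b₁ b₂ hA (b₁.h i) = b₂.h (eι i) := by
  unfold equivOfReindex
  rw [LieEquiv.trans_apply]
  refine LieEquiv.apply_symm_of_proj (y := (b₁.h i, b₂.h (eι i))) _ _ (fun _ ↦ rfl)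
    (fun _ ↦ rfl) ?_
  exact LieSubalgebra.subset_lieSpan (Or.inl (Or.inl ⟨i, rfl⟩))

namespace LieAlgebra.IsKilling

open LieModule LieAlgebra

variable {K L : Type*} [Field K] [CharZero K] [LieRing L] [LieAlgebra K L]
  [IsKilling K L] [FiniteDimensional K L]
  {H : LieSubalgebra K L} [H.IsCartanSubalgebra] [IsTriangularizable K H L]

theorem exists_lie_ne_zero {α β γ : Weight K H L} (hβ : β.IsNonZero)
    (hγ : (γ : H → K) = α + β) {h e f : L} (t : IsSl2Triple h e f)
    (he : e ∈ rootSpace H β) (hf : f ∈ rootSpace H (-β)) :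
    ∃ y ∈ rootSpace H α, ⁅e, y⁆ ≠ 0 := by
  obtain ⟨x, hx, x_ne0⟩ := (chainTop β α).exists_ne_zero
  have hp : 1 ≤ chainTopCoeff β α := by
    have := ((rootSpace_zsmul_add_ne_bot_iff β α hβ 1).1 (by
      rw [one_smul, add_comm, ← hγ]; exact γ.genWeightSpace_ne_bot)).1
    exact_mod_cast this
  obtain ⟨p, hp'⟩ := Nat.exists_eq_add_of_le' hp
  have prim : t.HasPrimitiveVectorWith x (chainLength β α : K) := by
    have := lie_mem_genWeightSpace_of_mem_genWeightSpace he hx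
    refine ⟨x_ne0, ?_, by rwa [genWeightSpace_add_chainTop _ _ hβ] at this⟩
    rw [t.h_eq_coroot hβ he hf]
    exact (chainLength_smul _ _ hx).symm
  have hle : p + 1 ≤ chainLength β α := hp' ▸ chainTopCoeff_le_chainLength β α
  -- `x` sits at the top of the `β`-string, `p + 1` steps above `α`. Applying `e` to `f ^ (p + 1) x`
  -- gives `(p + 1) * (chainLength β α - p)` times `f ^ p x`, and neither the factor nor the vector
  -- vanishes.
  refine ⟨((toEnd K L L f) ^ (p + 1)) x, ?_, ?_⟩
  · have := toEnd_pow_apply_mem hf hx (p + 1)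
    rwa [coe_chainTop', hp', smul_neg, neg_add_cancel_left] at this
  · rw [prim.lie_e_pow_succ_toEnd_f]
    refine smul_ne_zero (mul_ne_zero (by exact_mod_cast p.succ_ne_zero) ?_)
      (prim.pow_toEnd_f_ne_zero_of_eq_nat rfl (by omega))
    rw [sub_ne_zero]
    exact_mod_cast (by omega : chainLength β α ≠ p)

theorem rootSpace_le_of_mem {D : LieSubalgebra K L} {γ : Weight K H L} (hγ : γ.IsNonZero)
    {z : L} (hz : z ∈ rootSpace H γ) (hz0 : z ≠ 0) (hzD : z ∈ D) :
    ∀ y ∈ rootSpace H γ, y ∈ D := by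
  intro y hy
  obtain ⟨c, hc⟩ := (finrank_eq_one_iff_of_nonzero' (⟨z, hz⟩ : rootSpace H γ)
    (by simpa using hz0)).mp (finrank_rootSpace_eq_one γ hγ) ⟨y, hy⟩
  have : y = c • z := by simpa using congrArg Subtype.val hc.symm
  rw [this]
  exact D.smul_mem c hzD

theorem rootSpace_le_of_add {D : LieSubalgebra K L} {α β γ : Weight K H L} (hβ : β.IsNonZero)
    (hγ0 : γ.IsNonZero) (hγ : (γ : H → K) = α + β) (hα : ∀ y ∈ rootSpace H α, y ∈ D)
    (hβD : ∀ y ∈ rootSpace H β, y ∈ D) :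
    ∀ y ∈ rootSpace H γ, y ∈ D := by
  obtain ⟨h, e, f, t, he, hf⟩ := exists_isSl2Triple_of_weight_isNonZero hβ
  obtain ⟨y, hy, hne⟩ := exists_lie_ne_zero hβ hγ t he hf
  refine rootSpace_le_of_mem hγ0 (z := ⁅e, y⁆) ?_ hne (D.lie_mem (hβD e he) (hα y hy))
  have := lie_mem_genWeightSpace_of_mem_genWeightSpace he hy
  rwa [add_comm, ← hγ] at this

theorem coe_reflectionPerm_self (i : H.root) :
    ((rootSystem H).reflectionPerm i i : Weight K H L) = -(i : Weight K H L) := by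
  have h : (rootSystem H).root ((rootSystem H).reflectionPerm i i) = -(rootSystem H).root i := by
    rw [RootPairing.root_reflectionPerm, RootPairing.reflection_apply_self]
  ext x
  exact LinearMap.congr_fun h x

/-- Each positive root is reached by adding simple roots one at a time through roots, and root
spaces are lines. The Cartan subalgebra then comes from the brackets $[e,f]$. -/
theorem eq_top_of_forall_rootSpace_le (b : (rootSystem H).Base) (D : LieSubalgebra K L)
    (hpos : ∀ i ∈ b.support, ∀ y ∈ rootSpace H (i : Weight K H L), y ∈ D)
    (hneg : ∀ i ∈ b.support, ∀ y ∈ rootSpace H (-(i : Weight K H L) : H → K), y ∈ D) :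
    D = ⊤ := by
  have key : ∀ i, b.IsPos i → (∀ y ∈ rootSpace H (i : Weight K H L), y ∈ D) ∧
      ∀ y ∈ rootSpace H (-(i : Weight K H L) : Weight K H L), y ∈ D := by
    intro i hi
    refine hi.induction_on_add (p := fun i ↦ (∀ y ∈ rootSpace H (i : Weight K H L), y ∈ D) ∧
      ∀ y ∈ rootSpace H (-(i : Weight K H L) : Weight K H L), y ∈ D) (fun j hj ↦ ⟨hpos j hj, ?_⟩) ?_
    · simpa using hneg j hj
    · rintro i j k hk ⟨h1, h2⟩ hj
      have hk' : ((k : Weight K H L) : H → K) = (i : Weight K H L) + (j : Weight K H L) := by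
        funext x
        exact LinearMap.congr_fun hk x
      have hj0 := H.isNonZero_coe_root j
      have hk0 := H.isNonZero_coe_root k
      have hk'' : ((-(k : Weight K H L) : Weight K H L) : H → K) =
          (-(i : Weight K H L) : Weight K H L) + (-(j : Weight K H L) : Weight K H L) := by
        rw [Weight.coe_neg, Weight.coe_neg, Weight.coe_neg, hk', neg_add]
      have hj' : ∀ y ∈ rootSpace H (-(j : Weight K H L) : Weight K H L), y ∈ D := by
        rw [Weight.coe_neg]
        exact hneg j hj
      exact ⟨rootSpace_le_of_add hj0 hk0 hk' h1 (hpos j hj),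
        rootSpace_le_of_add hj0.neg hk0.neg hk'' h2 hj'⟩
  have hroot : ∀ i : H.root, ∀ y ∈ rootSpace H (i : Weight K H L), y ∈ D := by
    intro i
    rcases RootPairing.Base.IsPos.or_neg b i with h | h
    · exact (key i h).1
    · have h2 := (key _ h).2
      rw [RootPairing.indexNeg_neg, coe_reflectionPerm_self, neg_neg] at h2
      exact h2
  have hH : ∀ x : H, (x : L) ∈ D := by
    intro x
    have hx : x ∈ Submodule.span K (Set.range (rootSystem H).coroot) := by
      rw [RootPairing.IsRootSystem.span_coroot_eq_top]; trivial
    induction hx using Submodule.span_induction with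
    | mem x hx =>
      obtain ⟨i, rfl⟩ := hx
      obtain ⟨h, e, f, t, he, hf⟩ := exists_isSl2Triple_of_weight_isNonZero
        (H.isNonZero_coe_root i)
      have h1 := t.h_eq_coroot (H.isNonZero_coe_root i) he hf
      rw [rootSystem_coroot_apply, ← h1, ← t.lie_e_f]
      refine D.lie_mem (hroot i e he) ?_
      refine hroot ((rootSystem H).reflectionPerm i i) f ?_
      rw [coe_reflectionPerm_self, Weight.coe_neg]
      exact hf
    | zero => simp
    | add x y _ _ h1 h2 => exact D.add_mem h1 h2
    | smul c x _ h1 => exact D.smul_mem c h1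
  have htop := cartan_sup_iSup_rootSpace_eq_top (H := H)
  rw [eq_top_iff]
  intro x _
  have hx : x ∈ (H.toLieSubmodule ⊔ ⨆ α : Weight K H L, ⨆ (_ : α.IsNonZero), rootSpace H α :
      LieSubmodule K H L).toSubmodule := by rw [htop]; trivial
  rw [LieSubmodule.sup_toSubmodule, LieSubmodule.iSup_toSubmodule] at hx
  suffices h : _ ≤ D.toSubmodule from h hx
  refine sup_le (fun y hy ↦ hH ⟨y, hy⟩) (iSup_le fun α ↦ ?_)
  rw [LieSubmodule.iSup_toSubmodule]
  refine iSup_le fun hα y hy ↦ hroot ⟨α, by simpa using hα⟩ y hy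

theorem span_coroot_base_eq_top (b : (rootSystem H).Base) :
    Submodule.span K (Set.range fun i : b.support ↦ (rootSystem H).coroot i) = ⊤ := by
  have h := b.span_coroot_support
  have h2 : (rootSystem H).corootSpan K = ⊤ :=
    RootPairing.IsRootSystem.span_coroot_eq_top (P := rootSystem H)
  rw [h2] at h
  rw [← h]
  congr 1
  ext x
  simp

/-- A base of the root system extends to a basis of the Lie algebra in the sense of Chevalley
generators. -/
theorem exists_lieBasis_of_base (b : (rootSystem H).Base) :
    ∃ B : LieAlgebra.Basis b.support H, B.A = b.cartanMatrix ∧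
      ∀ i, B.h i = ((rootSystem H).coroot i : H) := by
  have ht (i : b.support) := exists_isSl2Triple_of_weight_isNonZero
    (H.isNonZero_coe_root (i : H.root))
  choose h e f t he hf using ht
  have hh (i : b.support) : h i = ((rootSystem H).coroot i : H) :=
    (t i).h_eq_coroot (H.isNonZero_coe_root (i : H.root)) (he i) (hf i)
  have hA (i j : b.support) : ((b.cartanMatrix i j : ℤ) : K) =
      ((i : H.root) : Weight K H L) ((rootSystem H).coroot j) := by
    have := b.algebraMap_cartanMatrixIn_apply ℤ i j
    simpa using this
  have hspan := span_coroot_base_eq_top b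
  refine ⟨⟨b.cartanMatrix, h, e, f, ?_, ?_, ?_, b.cartanMatrix_nondegenerate, t, ?_, ?_, ?_, ?_⟩,
    rfl, hh⟩
  · refine le_antisymm (fun x hx ↦ ?_) (LieSubalgebra.lieSpan_le.2 ?_)
    · have hx' : (⟨x, hx⟩ : H) ∈
          Submodule.span K (Set.range fun i : b.support ↦ (rootSystem H).coroot i) := by
        rw [hspan]; trivial
      have h1 := Submodule.mem_map_of_mem (f := H.toSubmodule.subtype) hx'
      rw [Submodule.map_span] at h1
      refine LieSubalgebra.submodule_span_le_lieSpan (R := K) (L := L) (s := Set.range h) ?_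
      have hr : Set.range h = H.toSubmodule.subtype ''
          Set.range fun i : b.support ↦ (rootSystem H).coroot i := by
        rw [← Set.range_comp]
        exact congrArg Set.range (funext hh)
      rw [hr]
      exact h1
    · rintro - ⟨i, rfl⟩
      rw [hh]
      exact Subtype.property _
  · refine eq_top_of_forall_rootSpace_le b _ ?_ ?_
    · intro i hi
      refine rootSpace_le_of_mem (H.isNonZero_coe_root i) (he ⟨i, hi⟩) (t ⟨i, hi⟩).e_ne_zero ?_
      exact LieSubalgebra.subset_lieSpan (Or.inl ⟨_, rfl⟩)
    · intro i hi
      have := rootSpace_le_of_mem (γ := -(i : Weight K H L)) (H.isNonZero_coe_root i).neg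
        (z := f ⟨i, hi⟩) (by rw [Weight.coe_neg]; exact hf ⟨i, hi⟩) (t ⟨i, hi⟩).f_ne_zero
        (D := LieSubalgebra.lieSpan K L (Set.range e ∪ Set.range f))
        (LieSubalgebra.subset_lieSpan (Or.inr ⟨_, rfl⟩))
      rwa [Weight.coe_neg] at this
  · have h1 := b.linearIndepOn_coroot
    have h2 := h1.linearIndependent.map' H.toSubmodule.subtype
      (LinearMap.ker_eq_bot.2 Subtype.val_injective)
    have h3 : h = fun i : b.support ↦ H.toSubmodule.subtype ((rootSystem H).coroot i) := by
      funext i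
      exact hh i
    rw [h3]
    exact h2
  · intro i j
    rw [hh, hh]
    have := LieSubalgebra.coe_bracket H ((rootSystem H).coroot i) ((rootSystem H).coroot j)
    rw [← this, trivial_lie_zero]
    rfl
  · intro i j
    have := lie_eq_smul_of_mem_rootSpace (he i) ((rootSystem H).coroot j)
    rw [← hA, Int.cast_smul_eq_zsmul] at this
    rw [hh]
    exact this
  · intro i j
    have := lie_eq_smul_of_mem_rootSpace (hf i) ((rootSystem H).coroot j)
    rw [Pi.neg_apply, ← hA, neg_smul, Int.cast_smul_eq_zsmul] at this
    rw [hh, neg_smul]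
    exact this
  -- $[e_i,f_j]$ has weight $\alpha_i-\alpha_j$, which is neither zero nor a root.
  · intro i j hij
    have hmem := lie_mem_genWeightSpace_of_mem_genWeightSpace (he i) (hf j)
    by_contra hne
    have hnb : genWeightSpace L (((i : H.root) : Weight K H L) + -((j : H.root) : Weight K H L) :
        H → K) ≠ ⊥ := by
      intro h0
      rw [h0, LieSubmodule.mem_bot] at hmem
      exact hne hmem
    let W : Weight K H L := ⟨_, hnb⟩
    have hW : (W.toLinear : Dual K H) =
        (rootSystem H).root i - (rootSystem H).root j := by
      ext x
      simp [W, sub_eq_add_neg]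
    by_cases hz : W.IsZero
    · have : (rootSystem H).root i = (rootSystem H).root j := by
        rw [← sub_eq_zero, ← hW]
        exact Weight.coe_toLinear_eq_zero_iff.2 hz
      exact hij (Subtype.ext ((rootSystem H).root.injective this))
    · refine b.sub_notMem_range_root i.2 j.2 ⟨⟨W, by simpa using hz⟩, ?_⟩
      rw [← hW]
      rfl

/-- Two bases of the root system of a simple Lie algebra with the same Cartan matrix are related
by an automorphism. -/
theorem exists_equiv_apply_coroot_eq [IsSimple K L] (b₁ b₂ : (rootSystem H).Base)
    (e : b₁.support ≃ b₂.support)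
    (he : ∀ i j, b₁.cartanMatrix i j = b₂.cartanMatrix (e i) (e j)) :
    ∃ σ : L ≃ₗ⁅K⁆ L, ∀ i : b₁.support,
      σ ((rootSystem H).coroot i : H) = ((rootSystem H).coroot (e i) : H) := by
  obtain ⟨B₁, hA₁, hh₁⟩ := exists_lieBasis_of_base b₁
  obtain ⟨B₂, hA₂, hh₂⟩ := exists_lieBasis_of_base b₂
  have hA : B₁.A.reindex e e = B₂.A := by
    ext i j
    simp [hA₁, hA₂, he]
  refine ⟨LieAlgebra.Basis.equivOfReindex e B₁ B₂ hA, fun i ↦ ?_⟩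
  rw [← hh₁, ← hh₂, LieAlgebra.Basis.equivOfReindex_apply_h]

end LieAlgebra.IsKilling

/-! ### Signed Weyl orbits and reflections between their members. -/

namespace RootPairing

section SignedOrbit

variable {ι K M N : Type*} [Field K] [CharZero K] [AddCommGroup M] [Module K M]
  [AddCommGroup N] [Module K N]

/-- The set of all `± w v` with `w` in the Weyl group. -/
inductive SignedOrbit (P : RootPairing ι K M N) (v : M) : Set M
  | base : SignedOrbit P v v
  | neg {a : M} : SignedOrbit P v a → SignedOrbit P v (-a)
  | reflection (i : ι) {a : M} : SignedOrbit P v a → SignedOrbit P v (P.reflection i a)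

/-- A signed Weyl orbit `S` each of whose lines is separated from the rest of `S` by a linear
functional, and which does not meet the lines spanned by the roots. -/
structure IsSignedFrame (P : RootPairing ι K M N) (v : M) (S : Set M) : Prop where
  base_mem : v ∈ S
  neg_mem : ∀ {a}, a ∈ S → -a ∈ S
  reflection_mem : ∀ (i : ι) {a}, a ∈ S → P.reflection i a ∈ S
  subset_of : ∀ C : Set M, v ∈ C → (∀ a ∈ C, -a ∈ C) → (∀ i, ∀ a ∈ C, P.reflection i a ∈ C) →
    S ⊆ C
  exists_dual : ∀ {a}, a ∈ S → ∃ x : Dual K M, x a = 1 ∧ ∀ b ∈ S, b ≠ a → b ≠ -a → x b = 0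
  ne_smul_root : ∀ {a}, a ∈ S → ∀ (i : ι) (t : K), a ≠ t • P.root i

/-- The functional given at `v` is carried along the orbit: negate it for `-a`, precompose it with
the reflection for a reflected vector. -/
theorem isSignedFrame_signedOrbit (P : RootPairing ι K M N) {v : M}
    (hv : ∀ (i : ι) (t : K), v ≠ t • P.root i) (x : Dual K M) (hx : x v = 1)
    (hx0 : ∀ b ∈ SignedOrbit P v, b ≠ v → b ≠ -v → x b = 0) :
    IsSignedFrame P v (SignedOrbit P v) where
  base_mem := .base
  neg_mem := .neg
  reflection_mem i _ := .reflection i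
  subset_of C h1 h2 h3 a ha := by
    induction ha with
    | base => exact h1
    | neg _ h => exact h2 _ h
    | reflection i _ h => exact h3 i _ h
  exists_dual {a} ha := by
    induction ha with
    | base => exact ⟨x, hx, hx0⟩
    | @neg a _ h =>
      obtain ⟨y, hy, hy0⟩ := h
      refine ⟨-y, by simp [hy], fun b hb h1 h2 ↦ ?_⟩
      rw [neg_neg] at h2
      simp [hy0 b hb h2 h1]
    | @reflection i a _ h =>
      obtain ⟨y, hy, hy0⟩ := h
      refine ⟨y ∘ₗ (P.reflection i).toLinearMap, by simp [hy], fun b hb h1 h2 ↦ ?_⟩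
      refine hy0 _ (.reflection i hb) (fun h ↦ h1 ?_) (fun h ↦ h2 ?_)
      · rw [← h]; simp
      · rw [← map_neg, ← h]; simp
  ne_smul_root {a} ha := by
    induction ha with
    | base => exact hv
    | neg _ h =>
      intro i t ht
      exact h i (-t) (by rw [neg_smul, ← ht, neg_neg])
    | @reflection j a _ h =>
      intro i t ht
      refine h (P.reflectionPerm j i) t ?_
      rw [root_reflectionPerm, ← map_smul, ← ht, reflection_same]

namespace IsSignedFrame

variable {P : RootPairing ι K M N} {v : M} {S : Set M} (hS : IsSignedFrame P v S)
include hS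

theorem ne_zero {a : M} (ha : a ∈ S) : a ≠ 0 := by
  obtain ⟨x, hx, -⟩ := hS.exists_dual ha
  rintro rfl
  simp at hx

omit hS in
theorem reflection_ne {a : M} {i : ι} (hi : P.coroot' i a ≠ 0) :
    P.reflection i a ≠ a := by
  intro h
  rw [reflection_apply, sub_eq_self, smul_eq_zero] at h
  exact h.elim hi (P.ne_zero i)

omit hS in
theorem reflection_ne_neg_of_ne_smul {a : M} {i : ι} (ha : ∀ t : K, a ≠ t • P.root i) :
    P.reflection i a ≠ -a := by
  intro h
  refine ha (2⁻¹ * P.coroot' i a) ?_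
  rw [reflection_apply, sub_eq_iff_eq_add] at h
  rw [mul_smul, show P.coroot' i a • P.root i = (2 : K) • a by
      rw [two_smul]; exact (eq_neg_add_iff_add_eq.1 h).symm,
    smul_smul, inv_mul_cancel₀ two_ne_zero, one_smul]

theorem reflection_ne_neg {a : M} (ha : a ∈ S) (i : ι) : P.reflection i a ≠ -a :=
  reflection_ne_neg_of_ne_smul (hS.ne_smul_root ha i)

omit hS in
theorem root_eq_smul_sub {a : M} {i : ι} (hi : P.coroot' i a ≠ 0) :
    P.root i = (P.coroot' i a)⁻¹ • (a - P.reflection i a) := by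
  rw [reflection_apply, sub_sub_cancel, smul_smul, inv_mul_cancel₀ hi, one_smul]

/-- If the reflection moved `d`, its root would be parallel to both `a - b` and `d` minus its image.
The functionals dual to `a` and to `b` would force that image onto the line of `a` and onto that of
`b`. -/
theorem coroot'_eq_zero {a b d : M} (ha : a ∈ S) (hb : b ∈ S) (hd : d ∈ S) (hab : a ≠ b)
    (hab' : a ≠ -b) (hda : d ≠ a) (hda' : d ≠ -a) (hdb : d ≠ b) (hdb' : d ≠ -b) {i : ι} {t : K}
    (hi : P.root i = t • (a - b)) : P.coroot' i d = 0 := by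
  by_contra hne
  have ht : t ≠ 0 := by
    rintro rfl
    exact P.ne_zero i (by rw [hi, zero_smul])
  have hroot := root_eq_smul_sub hne
  rw [hi] at hroot
  have key : ∀ {a b : M}, a ∈ S → b ∈ S → a ≠ b → a ≠ -b → d ≠ a → d ≠ -a → ∀ {t : K}, t ≠ 0 →
      t • (a - b) = (P.coroot' i d)⁻¹ • (d - P.reflection i d) →
      P.reflection i d = a ∨ P.reflection i d = -a := by
    intro a b ha hb hab hab' hda hda' t ht h
    obtain ⟨x, hx, hx0⟩ := hS.exists_dual ha
    by_contra! hcon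
    have h2 := congrArg x h
    rw [map_smul, map_smul, map_sub, map_sub, hx, hx0 b hb hab.symm (fun h ↦ hab' (by rw [h, neg_neg])),
      hx0 d hd hda hda', hx0 _ (hS.reflection_mem i hd) hcon.1 hcon.2] at h2
    simp [ht] at h2
  have h1 := key ha hb hab hab' hda hda' ht hroot
  have h2 := key hb ha hab.symm (fun h ↦ hab' (by rw [h, neg_neg])) hdb hdb' (neg_ne_zero.2 ht)
    (by rw [← hroot, neg_smul, ← smul_neg, neg_sub])
  rcases h1 with h1 | h1 <;> rcases h2 with h2 | h2 <;> rw [h1] at h2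
  · exact hab h2
  · exact hab' h2
  · exact hab' (by rw [← h2, neg_neg])
  · exact hab (neg_injective h2)

end IsSignedFrame

/-- The relation on a signed frame that `a` and `b` span different lines and some reflection with
`⟨a, αᵢᵛ⟩ = k` maps `a` to `b`. -/
def ReflectsTo (P : RootPairing ι K M N) (k : K) (a b : M) : Prop :=
  a ≠ b ∧ a ≠ -b ∧ ∃ i, P.reflection i a = b ∧ P.coroot' i a = k

namespace ReflectsTo

variable {P : RootPairing ι K M N} {k k' : K} {a b d : M}

theorem coroot'_reflection_self (P : RootPairing ι K M N) (i : ι) (a : M) :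
    P.coroot' i (P.reflection i a) = -P.coroot' i a := by
  rw [reflection_apply, map_sub, map_smul, smul_eq_mul, root_coroot'_eq_pairing, pairing_same]
  ring

theorem coroot'_reflectionPerm_self (P : RootPairing ι K M N) (i : ι) (a : M) :
    P.coroot' (P.reflectionPerm i i) a = -P.coroot' i a := by
  rw [← coroot'_reflection, coroot'_reflection_self]

theorem reflection_reflectionPerm_self (P : RootPairing ι K M N) (i : ι) (a : M) :
    P.reflection (P.reflectionPerm i i) a = P.reflection i a := by
  rw [reflection_apply, coroot'_reflectionPerm_self, root_reflectionPerm, reflection_apply_self,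
    smul_neg, neg_smul, neg_neg, reflection_apply]

/-- The opposite root defines the same reflection with the opposite coroot value, so the scale only
matters up to sign. -/
theorem negScale (h : P.ReflectsTo k a b) : P.ReflectsTo (-k) a b := by
  obtain ⟨h1, h2, i, h3, h4⟩ := h
  exact ⟨h1, h2, P.reflectionPerm i i, by rw [reflection_reflectionPerm_self, h3],
    by rw [coroot'_reflectionPerm_self, h4]⟩

theorem neg (h : P.ReflectsTo k a b) : P.ReflectsTo k (-a) (-b) := by
  obtain ⟨h1, h2, i, h3, h4⟩ := h.negScale
  exact ⟨fun h ↦ h1 (neg_injective h), fun h ↦ h2 (neg_injective h), i,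
    by rw [map_neg, h3], by rw [map_neg, h4, neg_neg]⟩

theorem symm (h : P.ReflectsTo k a b) : P.ReflectsTo k b a := by
  obtain ⟨h1, h2, i, h3, h4⟩ := h.negScale
  refine ⟨h1.symm, fun h ↦ h2 (by rw [h, neg_neg]), i, by rw [← h3, reflection_same], ?_⟩
  rw [← h3, coroot'_reflection_self, h4, neg_neg]

theorem ne_zero (h : P.ReflectsTo k a b) : k ≠ 0 := by
  obtain ⟨h1, h2, i, h3, h4⟩ := h
  rintro rfl
  rw [reflection_apply, h4, zero_smul, sub_zero] at h3
  exact h1 h3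

theorem exists_root (h : P.ReflectsTo k a b) : ∃ i, P.reflection i a = b ∧ P.coroot' i a = k ∧
    P.root i = k⁻¹ • (a - b) := by
  have hk := h.ne_zero
  obtain ⟨h1, h2, i, h3, h4⟩ := h
  refine ⟨i, h3, h4, ?_⟩
  rw [← h4] at hk ⊢
  rw [IsSignedFrame.root_eq_smul_sub hk, h3]

/-- The second reflection fixes `a`, so conjugating the first by the second sends `a` to `d`. The
coroot value at `a` stays that of the first step, which is what later yields a common scale. -/
theorem trans {v : M} {S : Set M} (hS : IsSignedFrame P v S) (ha : a ∈ S) (hb : b ∈ S)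
    (hd : d ∈ S) (h : P.ReflectsTo k a b) (h' : P.ReflectsTo k' b d) (h1 : a ≠ d) (h2 : a ≠ -d) :
    P.ReflectsTo k a d := by
  obtain ⟨i, hi, hik, -⟩ := h.exists_root
  obtain ⟨j, hj, hjk, hroot⟩ := h'.exists_root
  have hfix : P.reflection j a = a := by
    rw [reflection_apply, hS.coroot'_eq_zero hb hd ha h'.1 h'.2.1 h.1 h.2.1 h1 h2 hroot, zero_smul,
      sub_zero]
  refine ⟨h1, h2, P.reflectionPerm j i, ?_, ?_⟩
  · rw [reflection_reflectionPerm]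
    change P.reflection j (P.reflection i (P.reflection j a)) = d
    rw [hfix, hi, hj]
  · rw [← coroot'_reflection, hfix, hik]

end ReflectsTo

end SignedOrbit
end RootPairing

/-! ### Irreducibility joins all pairs with one scale. -/

namespace RootPairing

section Frame

variable {ι K M N : Type*} [Field K] [CharZero K] [AddCommGroup M] [Module K M]
  [AddCommGroup N] [Module K N] {P : RootPairing ι K M N} {v : M} {S : Set M}

theorem eq_top_of_reflection_mem [P.IsIrreducible] (q : Submodule K M) {w : M} (hw : w ∈ q)
    (hw0 : w ≠ 0) (h : ∀ i, ∀ a ∈ q, P.reflection i a ∈ q) : q = ⊤ :=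
  IsIrreducible.eq_top_of_invtSubmodule_reflection (P := P) q (fun i a ha ↦ h i a ha)
    (fun h0 ↦ hw0 (by simpa [h0] using hw))

theorem span_eq_top_of_reflection_mem [P.IsIrreducible] (s : Set M) {w : M} (hw : w ∈ s)
    (hw0 : w ≠ 0) (h : ∀ i, ∀ a ∈ s, P.reflection i a ∈ Submodule.span K s) :
    Submodule.span K s = ⊤ := by
  refine eq_top_of_reflection_mem (P := P) _ (Submodule.subset_span hw) hw0 fun i a ha ↦ ?_
  have : Submodule.span K s ≤ (Submodule.span K s).comap (P.reflection i).toLinearMap :=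
    Submodule.span_le.2 fun b hb ↦ h i b hb
  exact this ha

namespace IsSignedFrame

variable (hS : IsSignedFrame P v S)
include hS

theorem span_eq_top [P.IsIrreducible] : Submodule.span K S = ⊤ :=
  span_eq_top_of_reflection_mem (P := P) S hS.base_mem (hS.ne_zero hS.base_mem)
    fun i _ ha ↦ Submodule.subset_span (hS.reflection_mem i ha)

theorem exists_coroot'_ne_zero [P.IsIrreducible] (i : ι) : ∃ a ∈ S, P.coroot' i a ≠ 0 := by
  by_contra! h
  have h1 : Submodule.span K S ≤ LinearMap.ker (P.coroot' i) := Submodule.span_le.2 h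
  rw [hS.span_eq_top, top_le_iff, LinearMap.ker_eq_top] at h1
  have := P.root_coroot'_eq_pairing i i
  rw [h1, pairing_same] at this
  simp at this

theorem linearIndepOn {C : Set M} (hC : C ⊆ S) (h : ∀ a ∈ C, ∀ b ∈ C, a ≠ -b) :
    LinearIndepOn K id C := by
  have hx (a : C) := hS.exists_dual (hC a.2)
  choose x hx hx0 using hx
  refine LinearIndependent.of_pairwise_dual_eq_zero_one _ x (fun a b hab ↦ ?_) (fun a ↦ ?_)
  · refine hx0 a b (hC b.2) (fun hba ↦ hab (Subtype.ext hba.symm)) (h b b.2 a a.2)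
  · exact hx a

theorem exists_reflectsTo {a : M} (ha : a ∈ S) {i : ι} (hi : P.coroot' i a ≠ 0) :
    P.ReflectsTo (P.coroot' i a) a (P.reflection i a) :=
  ⟨(reflection_ne hi).symm, fun h ↦ hS.reflection_ne_neg ha i (neg_eq_iff_eq_neg.2 h).symm, i, rfl, rfl⟩

omit hS in
theorem ne_of_ne_neg {a b : M} (h : a ≠ -b) : b ≠ -a := fun h' ↦ h (by rw [h', neg_neg])

/-- One pair `±b` reached from `v` suffices for all: the chain `b'`, `v`, `b`, `-v` joins `b'` to
`-v`, hence `v` to `-b'`. -/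
theorem reflectsTo_neg_of_exists {b b' : M} (hb : b ∈ S) (hb' : b' ∈ S)
    {k₁ k₂ k₃ : K} (h1 : P.ReflectsTo k₁ v b) (h2 : P.ReflectsTo k₂ v (-b))
    (h3 : P.ReflectsTo k₃ v b') : ∃ k, P.ReflectsTo k v (-b') := by
  have hv := hS.base_mem
  by_cases e1 : b' = b
  · exact ⟨_, e1 ▸ h2⟩
  by_cases e2 : b' = -b
  · exact ⟨_, by rw [e2, neg_neg]; exact h1⟩
  have h4 := ReflectsTo.trans hS hb' hv hb h3.symm h1 e1 e2
  have h5 : P.ReflectsTo k₂ b (-v) := by simpa using h2.neg.symm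
  have h6 := ReflectsTo.trans hS hb' hb (hS.neg_mem hv) h4 h5 (ne_of_ne_neg h3.2.1)
    (by rw [neg_neg]; exact h3.1.symm)
  exact ⟨_, by simpa using h6.neg.symm⟩

theorem exists_reflectsTo_base [P.IsRootSystem] :
    ∃ b ∈ S, ∃ k, P.ReflectsTo k v b := by
  by_contra! h
  refine hS.ne_zero hS.base_mem ((eq_zero_iff_forall_coroot'_eq_zero P).2 fun i ↦ ?_)
  by_contra hi
  exact h _ (hS.reflection_mem i hS.base_mem) _ (hS.exists_reflectsTo hS.base_mem hi)

/-- Some pair `±b` of a signed frame consists of reflections of the base vector: otherwise the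
differences of the reflections of `v` would span a proper invariant subspace. -/
theorem exists_reflectsTo_neg [P.IsRootSystem] [P.IsIrreducible] :
    ∃ b ∈ S, ∃ k₁ k₂, P.ReflectsTo k₁ v b ∧ P.ReflectsTo k₂ v (-b) := by
  by_contra! hcon
  obtain ⟨b₀, hb₀, k₀, h₀⟩ := hS.exists_reflectsTo_base
  set C : Set M := {a | a ∈ S ∧ (a = v ∨ ∃ k, P.ReflectsTo k v a)} with hCdef
  have hv := hS.base_mem
  have hvC : v ∈ C := ⟨hv, Or.inl rfl⟩
  have hrefl : ∀ i, ∀ a ∈ C, P.reflection i a ∈ C := by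
    rintro i a ⟨ha, h⟩
    refine ⟨hS.reflection_mem i ha, ?_⟩
    by_cases hi : P.coroot' i a = 0
    · rwa [reflection_apply, hi, zero_smul, sub_zero]
    have hR := hS.exists_reflectsTo ha hi
    rcases h with rfl | ⟨k, h⟩
    · exact Or.inr ⟨_, hR⟩
    · by_cases e1 : P.reflection i a = v
      · exact Or.inl e1
      by_cases e2 : P.reflection i a = -v
      · rw [e2] at hR
        exact absurd (by simpa using hR.neg.symm) (hcon a ha _ _ h)
      · exact Or.inr ⟨_, ReflectsTo.trans hS hv ha (hS.reflection_mem i ha) h hR (Ne.symm e1)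
          (ne_of_ne_neg e2)⟩
  have hind : LinearIndepOn K id C := by
    refine hS.linearIndepOn (fun a ha ↦ ha.1) ?_
    rintro a ⟨ha, h⟩ b ⟨hb, h'⟩ hab
    rcases h with h | ⟨k, h⟩ <;> rcases h' with h' | ⟨k', h'⟩
    · have h2 : (2 : K) • a = 0 := by
        rw [two_smul]
        nth_rw 1 [hab]
        rw [h', h, neg_add_cancel]
      exact hS.ne_zero ha ((smul_eq_zero.1 h2).resolve_left two_ne_zero)
    · exact h'.2.1 (h ▸ hab)
    · exact h.2.1 (by rw [hab, neg_neg, h'])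
    · exact hcon b hb _ _ h' (hab ▸ h)
  obtain ⟨φ, hφ⟩ : ∃ φ : Dual K M, ∀ a ∈ C, φ a = 1 := by
    refine ⟨(Basis.extend hind).constr K fun _ ↦ (1 : K), fun a ha ↦ ?_⟩
    have : a = Basis.extend hind ⟨a, hind.subset_extend _ ha⟩ := by simp
    rw [this, Basis.constr_basis]
  have htop := span_eq_top_of_reflection_mem (P := P) {w | ∃ a ∈ C, ∃ b ∈ C, w = a - b}
    (w := v - b₀) ⟨v, hvC, b₀, ⟨hb₀, Or.inr ⟨_, h₀⟩⟩, rfl⟩ (sub_ne_zero.2 h₀.1) (by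
      rintro i - ⟨a, ha, b, hb, rfl⟩
      exact Submodule.subset_span ⟨_, hrefl i a ha, _, hrefl i b hb, map_sub _ _ _⟩)
  have hker : Submodule.span K {w | ∃ a ∈ C, ∃ b ∈ C, w = a - b} ≤ LinearMap.ker φ := by
    refine Submodule.span_le.2 ?_
    rintro - ⟨a, ha, b, hb, rfl⟩
    simp [hφ a ha, hφ b hb]
  rw [htop, top_le_iff, LinearMap.ker_eq_top] at hker
  have := hφ v hvC
  rw [hker] at this
  simp at this

/-- The vectors `±v` together with those joined to `v` form a set stable under negation and all
reflections, so they exhaust the orbit. -/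
theorem reflectsTo_of_base_ne [P.IsRootSystem] [P.IsIrreducible] {b : M} (hb : b ∈ S) (h1 : b ≠ v) (h2 : b ≠ -v) :
    ∃ k, P.ReflectsTo k v b := by
  obtain ⟨b₀, hb₀, k₁, k₂, hk₁, hk₂⟩ := hS.exists_reflectsTo_neg
  have hv := hS.base_mem
  have key : S ⊆ {a | a ∈ S ∧ (a = v ∨ a = -v ∨ ∃ k, P.ReflectsTo k v a)} := by
    have hneg : ∀ a ∈ {a | a ∈ S ∧ (a = v ∨ a = -v ∨ ∃ k, P.ReflectsTo k v a)},
        -a ∈ {a | a ∈ S ∧ (a = v ∨ a = -v ∨ ∃ k, P.ReflectsTo k v a)} := by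
      rintro a ⟨ha, rfl | rfl | ⟨k, hk⟩⟩
      · exact ⟨hS.neg_mem ha, Or.inr (Or.inl rfl)⟩
      · exact ⟨hS.neg_mem ha, Or.inl (neg_neg _)⟩
      · exact ⟨hS.neg_mem ha, Or.inr (Or.inr (hS.reflectsTo_neg_of_exists hb₀ ha hk₁ hk₂ hk))⟩
    have hreflv : ∀ i, P.reflection i v ∈
        {a | a ∈ S ∧ (a = v ∨ a = -v ∨ ∃ k, P.ReflectsTo k v a)} := by
      intro i
      refine ⟨hS.reflection_mem i hv, ?_⟩
      by_cases hi : P.coroot' i v = 0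
      · left; rw [reflection_apply, hi, zero_smul, sub_zero]
      · exact Or.inr (Or.inr ⟨_, hS.exists_reflectsTo hv hi⟩)
    refine hS.subset_of _ ⟨hv, Or.inl rfl⟩ hneg ?_
    rintro i a ⟨ha, rfl | rfl | ⟨k, hk⟩⟩
    · exact hreflv i
    · rw [map_neg]
      exact hneg _ (hreflv i)
    · refine ⟨hS.reflection_mem i ha, ?_⟩
      by_cases hi : P.coroot' i a = 0
      · right; right; rw [reflection_apply, hi, zero_smul, sub_zero]; exact ⟨k, hk⟩
      by_cases e1 : P.reflection i a = v
      · exact Or.inl e1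
      by_cases e2 : P.reflection i a = -v
      · exact Or.inr (Or.inl e2)
      exact Or.inr (Or.inr ⟨_, ReflectsTo.trans hS hv ha (hS.reflection_mem i ha) hk
        (hS.exists_reflectsTo ha hi) (Ne.symm e1) (ne_of_ne_neg e2)⟩)
  rcases (key hb).2 with h | h | h
  · exact absurd h h1
  · exact absurd h h2
  · exact h

theorem exists_reflectsTo_of_ne [P.IsRootSystem] [P.IsIrreducible] {a b : M} (ha : a ∈ S) (hb : b ∈ S)
    (h1 : a ≠ b) (h2 : a ≠ -b) : ∃ k, P.ReflectsTo k a b := by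
  have hv := hS.base_mem
  by_cases e1 : a = v
  · subst e1
    exact hS.reflectsTo_of_base_ne hb h1.symm (ne_of_ne_neg h2)
  by_cases e2 : a = -v
  · obtain ⟨k, hk⟩ := hS.reflectsTo_of_base_ne (hS.neg_mem hb) (b := -b)
      (fun h ↦ h1 (by rw [e2, ← h, neg_neg])) (fun h ↦ h2 (by rw [e2, ← h]))
    exact ⟨k, by rw [e2]; simpa using hk.neg⟩
  obtain ⟨k, hk⟩ := hS.reflectsTo_of_base_ne ha e1 e2
  by_cases e3 : b = v
  · subst e3
    exact ⟨k, hk.symm⟩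
  by_cases e4 : b = -v
  · obtain ⟨k', hk'⟩ := hS.reflectsTo_of_base_ne (hS.neg_mem ha) (b := -a)
      (fun h ↦ e2 (by rw [← h, neg_neg])) (fun h ↦ e1 (neg_injective h))
    exact ⟨k', by rw [e4]; simpa using hk'.neg.symm⟩
  obtain ⟨k', hk'⟩ := hS.reflectsTo_of_base_ne hb e3 e4
  exact ⟨k, ReflectsTo.trans hS ha hv hb hk.symm hk' h1 h2⟩

/-- With only the lines of `a` and `b`, every reflection would preserve the line of `a - b`, as in
the reducible system $D_2$. Irreducibility would make that line the whole space, against the dual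
functionals. -/
theorem exists_third [P.IsIrreducible] {a b : M} (ha : a ∈ S) (hb : b ∈ S)
    (h1 : a ≠ b) (h2 : a ≠ -b) : ∃ d ∈ S, d ≠ a ∧ d ≠ -a ∧ d ≠ b ∧ d ≠ -b := by
  by_contra! hcon
  have htop := span_eq_top_of_reflection_mem (P := P) {a - b} (w := a - b) rfl
    (sub_ne_zero.2 h1) (by
      rintro i - rfl
      have hab := Submodule.mem_span_singleton_self (R := K) (a - b)
      rw [map_sub]
      by_cases hi : P.reflection i a = a
      · have : P.reflection i b = b := by
          by_contra hb'
          have e1 := hcon (P.reflection i b) (hS.reflection_mem i hb)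
            (fun h ↦ h1 ((P.reflection i).injective (by rw [hi, h])))
            (fun h ↦ ne_of_ne_neg h2 ((P.reflection i).injective (by rw [map_neg, hi, h]))) hb'
          exact hS.reflection_ne_neg hb i e1
        rw [hi, this]
        exact hab
      · have hne := hS.reflection_ne_neg ha i
        by_cases e : P.reflection i a = b
        · have : P.reflection i b = a := by rw [← e, reflection_same]
          rw [e, this]
          have hba := Submodule.neg_mem _ hab
          rwa [neg_sub] at hba
        · have e' := hcon _ (hS.reflection_mem i ha) hi hne e
          have : P.reflection i b = -a := by
            rw [← reflection_same P i a, e', map_neg, neg_neg]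
          rw [e', this, neg_sub_neg]
          exact hab)
  obtain ⟨x, hx, hx0⟩ := hS.exists_dual ha
  obtain ⟨y, hy, hy0⟩ := hS.exists_dual hb
  have hmem : a ∈ Submodule.span K {a - b} := by rw [htop]; trivial
  obtain ⟨t, ht⟩ := Submodule.mem_span_singleton.1 hmem
  have hyt := congrArg y ht
  have hxt := congrArg x ht
  rw [map_smul, map_sub, hx, hx0 b hb h1.symm (ne_of_ne_neg h2)] at hxt
  rw [map_smul, map_sub, hy, hy0 a ha h1 h2] at hyt
  simp only [smul_eq_mul] at hxt hyt
  have h01 : (1 : K) = 0 := by linear_combination (-1 : K) * hxt - hyt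
  exact one_ne_zero h01

/-- All pairs in a signed frame are related by reflections with a common scale. -/
theorem exists_scale [P.IsRootSystem] [P.IsIrreducible] :
    ∃ k : K, ∀ a ∈ S, ∀ b ∈ S, a ≠ b → a ≠ -b → P.ReflectsTo k a b := by
  obtain ⟨b₀, hb₀, k, hk⟩ := hS.exists_reflectsTo_base
  have hv := hS.base_mem
  refine ⟨k, ?_⟩
  have hv1 : ∀ d ∈ S, d ≠ v → d ≠ -v → d ≠ b₀ → d ≠ -b₀ → P.ReflectsTo k v d := by
    intro d hd h1 h2 h3 h4
    obtain ⟨k', hk'⟩ := hS.exists_reflectsTo_of_ne hb₀ hd h3.symm (ne_of_ne_neg h4)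
    exact ReflectsTo.trans hS hv hb₀ hd hk hk' h1.symm (ne_of_ne_neg h2)
  have hv2 : ∀ d ∈ S, d ≠ v → d ≠ -v → P.ReflectsTo k v d := by
    intro d hd h1 h2
    by_cases e1 : d = b₀
    · rwa [e1]
    by_cases e2 : d = -b₀
    -- `-b₀` is on the line of `b₀`, so transitivity through `b₀` does not apply; a third line
    -- serves as the intermediate step.
    · obtain ⟨c, hc, hc1, hc2, hc3, hc4⟩ := hS.exists_third hv hb₀ hk.1 hk.2.1
      obtain ⟨k', hk'⟩ := hS.exists_reflectsTo_of_ne hc hd (e2 ▸ hc4)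
        (by rw [e2, neg_neg]; exact hc3)
      exact ReflectsTo.trans hS hv hc hd (hv1 c hc hc1 hc2 hc3 hc4) hk' h1.symm (ne_of_ne_neg h2)
    exact hv1 d hd h1 h2 e1 e2
  intro a ha b hb h1 h2
  by_cases e1 : a = v
  · subst e1
    exact hv2 b hb h1.symm (ne_of_ne_neg h2)
  by_cases e2 : a = -v
  · have := hv2 (-b) (hS.neg_mem hb)
      (fun h ↦ h1 (by rw [e2, ← h, neg_neg])) (fun h ↦ h2 (by rw [e2, ← h]))
    rw [e2]
    simpa using this.neg
  have hk := hv2 a ha e1 e2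
  by_cases e3 : b = v
  · subst e3
    exact hk.symm
  by_cases e4 : b = -v
  · have := hv2 (-a) (hS.neg_mem ha)
      (fun h ↦ e2 (by rw [← h, neg_neg])) (fun h ↦ e1 (neg_injective h))
    rw [e4]
    simpa using this.neg.symm
  have hk' := hv2 b hb e3 e4
  exact (ReflectsTo.trans hS hb hv ha hk'.symm hk h1.symm (ne_of_ne_neg h2)).symm

end IsSignedFrame

end Frame
end RootPairing

/-! ### The roots in terms of the frame, and the bound on the scale. -/

namespace RootPairing

section Scale

variable {ι K M N : Type*} [Field K] [CharZero K] [AddCommGroup M] [Module K M]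
  [AddCommGroup N] [Module K N] {P : RootPairing ι K M N} {v : M} {S : Set M}

/-- A signed frame whose pairs are all related by reflections with the common scale `k`. -/
structure IsScaledFrame (P : RootPairing ι K M N) (v : M) (S : Set M) (k : K) : Prop extends
    IsSignedFrame P v S where
  reflectsTo : ∀ a ∈ S, ∀ b ∈ S, a ≠ b → a ≠ -b → P.ReflectsTo k a b

namespace IsScaledFrame

theorem negScale {k : K} (hS : IsScaledFrame P v S k) : IsScaledFrame P v S (-k) :=
  ⟨hS.toIsSignedFrame, fun a ha b hb h1 h2 ↦ (hS.reflectsTo a ha b hb h1 h2).negScale⟩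

variable {k : K} (hS : IsScaledFrame P v S k)
include hS

theorem exists_root {a b : M} (ha : a ∈ S) (hb : b ∈ S) (h1 : a ≠ b) (h2 : a ≠ -b) :
    ∃ i, P.root i = k⁻¹ • (a - b) ∧ P.coroot' i a = k ∧ P.coroot' i b = -k ∧
      ∀ d ∈ S, d ≠ a → d ≠ -a → d ≠ b → d ≠ -b → P.coroot' i d = 0 := by
  obtain ⟨i, hi, hk, hr⟩ := (hS.reflectsTo a ha b hb h1 h2).exists_root
  refine ⟨i, hr, hk, ?_, fun d hd e1 e2 e3 e4 ↦
    hS.coroot'_eq_zero ha hb hd h1 h2 e1 e2 e3 e4 hr⟩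
  rw [← hi, ReflectsTo.coroot'_reflection_self, hk]

theorem exists_ne [P.IsRootSystem] [P.IsIrreducible] {a : M} (ha : a ∈ S) :
    ∃ b ∈ S, a ≠ b ∧ a ≠ -b := by
  by_contra! h
  have hz : ∀ i, P.coroot' i a = 0 := by
    intro i
    by_contra hi
    have hR := hS.exists_reflectsTo ha hi
    exact hR.2.1 (h _ (hS.reflection_mem i ha) hR.1)
  exact hS.ne_zero ha ((eq_zero_iff_forall_coroot'_eq_zero P).2 hz)

/-- The given root is parallel to a difference of frame vectors, and so is the root that the scale
provides; reducedness makes them equal up to sign. -/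
theorem exists_root_eq [P.IsReduced] [P.IsIrreducible] (i : ι) :
    ∃ a ∈ S, ∃ b ∈ S, a ≠ b ∧ a ≠ -b ∧ P.root i = k⁻¹ • (a - b) := by
  obtain ⟨a, ha, hi⟩ := hS.exists_coroot'_ne_zero i
  have hb := hS.reflection_mem i ha
  have hR := hS.exists_reflectsTo ha hi
  obtain ⟨j, hj, -⟩ := hS.exists_root ha hb hR.1 hR.2.1
  have hroot := IsSignedFrame.root_eq_smul_sub hi
  have hk := (hS.reflectsTo a ha _ hb hR.1 hR.2.1).ne_zero
  have hdep : ¬ LinearIndependent K ![P.root i, P.root j] := by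
    rw [LinearIndependent.pair_iff' (P.ne_zero i)]
    push Not
    refine ⟨P.coroot' i a * k⁻¹, ?_⟩
    rw [hj, hroot, smul_smul]
    congr 1
    field_simp
  rcases IsReduced.eq_or_eq_neg i j hdep with h | h
  · exact ⟨a, ha, _, hb, hR.1, hR.2.1, by rw [h, hj]⟩
  · exact ⟨_, hb, a, ha, hR.1.symm, IsSignedFrame.ne_of_ne_neg hR.2.1, by
      rw [h, hj, ← smul_neg, neg_sub]⟩

/-- The value of the functional dual to `d ∈ S` on a root. -/
theorem dual_root [P.IsReduced] [P.IsIrreducible] {d : M} (hd : d ∈ S) {x : Dual K M}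
    (hx : x d = 1) (hx0 : ∀ b ∈ S, b ≠ d → b ≠ -d → x b = 0) (i : ι) :
    x (P.root i) = 0 ∨ x (P.root i) = k⁻¹ ∨ x (P.root i) = -k⁻¹ := by
  obtain ⟨a, ha, b, hb, h1, h2, hr⟩ := hS.exists_root_eq i
  have hval : ∀ c ∈ S, x c = 0 ∨ ((c = d ∨ c = -d) ∧ (x c = 1 ∨ x c = -1)) := by
    intro c hc
    by_cases e1 : c = d
    · right; exact ⟨Or.inl e1, Or.inl (by rw [e1, hx])⟩
    by_cases e2 : c = -d
    · right; exact ⟨Or.inr e2, Or.inr (by rw [e2, map_neg, hx])⟩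
    · left; exact hx0 c hc e1 e2
  rw [hr, map_smul, map_sub, smul_eq_mul]
  rcases hval a ha with h | ⟨h, h'⟩ <;> rcases hval b hb with h3 | ⟨h3, h3'⟩
  · left; rw [h, h3]; ring
  · rcases h3' with h3' | h3' <;> rw [h, h3']
    · right; right; ring
    · right; left; ring
  · rcases h' with h' | h' <;> rw [h', h3]
    · right; left; ring
    · right; right; ring
  · exfalso
    rcases h with h | h <;> rcases h3 with h3 | h3 <;> subst h <;> subst h3
    all_goals simp_all

/-- A scaled frame of scale `k ≥ 3` violates the planarity condition on the weights. -/
theorem natCast_scale_le_two [P.IsRootSystem] [P.IsReduced] [P.IsIrreducible] {n : ℕ}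
    (hn : k = n) {l : M} (hl : l ∈ S) {Ω : Set M} {x : Dual K M} (hx : x v = 1)
    (hx0 : ∀ b ∈ S, b ≠ v → b ≠ -v → x b = 0)
    (hstring : ∀ i, ∀ m : ℕ, P.coroot' i l = m → 0 < m → ∀ j ≤ m, l - (j : K) • P.root i ∈ Ω)
    (hΩ : ∀ ν ∈ Ω, x ν = 0 ∨ ∃ ε : K, (ε = 1 ∨ ε = -1) ∧
      (ν = ε • v ∨ ∃ i, ν = ε • v + P.root i)) : n ≤ 2 := by
  by_contra! hn2
  have hv := hS.base_mem
  have hk0 : k ≠ 0 := by rw [hn]; exact_mod_cast (by omega)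
  have hk2 : k - 2 ≠ 0 := by
    rw [hn, sub_ne_zero]; exact_mod_cast (by omega)
  -- The weight `ν` has coordinate $2/k$ along a frame vector `d` off the line of `v`, whereas $\pm
  -- v$ plus a root or zero has only $0$ or $\pm1/k$ there. If `l = ±v`, go two steps from `l`
  -- towards another frame vector; otherwise go `n - 2` steps from `l` towards `v`. Both leave `x ν
  -- ≠ 0` because `k ≠ 2`.
  obtain ⟨y, d, hd, hdv, hdv', hyd, hyd0, ν, hν, hxν, hyν⟩ : ∃ (y : Dual K M) (d : M), d ∈ S ∧
      v ≠ d ∧ v ≠ -d ∧ y d = 1 ∧ (∀ b ∈ S, b ≠ d → b ≠ -d → y b = 0) ∧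
      ∃ ν ∈ Ω, x ν ≠ 0 ∧ y ν = 2 * k⁻¹ := by
    by_cases hlv : l = v ∨ l = -v
    · obtain ⟨b, hb, h1, h2⟩ := hS.exists_ne hl
      obtain ⟨i, hi, hk, -⟩ := hS.exists_root hl hb h1 h2
      obtain ⟨y, hy, hy0⟩ := hS.exists_dual hb
      have hbv : b ≠ v ∧ b ≠ -v := by
        rcases hlv with rfl | rfl
        · exact ⟨h1.symm, IsSignedFrame.ne_of_ne_neg h2⟩
        · exact ⟨fun h ↦ h2 (by rw [h]), h1.symm⟩
      refine ⟨y, b, hb, hbv.1.symm, IsSignedFrame.ne_of_ne_neg hbv.2, hy, hy0, _,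
        hstring i n (by rw [hk, hn]) (by omega) 2 (by omega), ?_, ?_⟩
      · rw [map_sub, map_smul, hi, map_smul, map_sub, hx0 b hb hbv.1 hbv.2]
        have : x l ≠ 0 := by rcases hlv with h | h <;> rw [h] <;> simp [hx]
        have h3 : x l - ((2 : ℕ) : K) • k⁻¹ • (x l - 0) = x l * ((k - 2) * k⁻¹) := by
          simp only [smul_eq_mul, Nat.cast_ofNat]
          field_simp
          ring
        rw [h3]
        exact mul_ne_zero this (mul_ne_zero hk2 (inv_ne_zero hk0))
      · rw [map_sub, map_smul, hi, map_smul, map_sub, hy, hy0 l hl h1 h2]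
        simp only [smul_eq_mul, Nat.cast_ofNat]
        ring
    · push Not at hlv
      obtain ⟨i, hi, hk, -⟩ := hS.exists_root hl hv hlv.1 hlv.2
      obtain ⟨y, hy, hy0⟩ := hS.exists_dual hl
      have hvl := hy0 v hv hlv.1.symm (IsSignedFrame.ne_of_ne_neg hlv.2)
      have hcast : ((n - 2 : ℕ) : K) = k - 2 := by
        rw [hn, Nat.cast_sub (by omega)]; simp
      refine ⟨y, l, hl, hlv.1.symm, IsSignedFrame.ne_of_ne_neg hlv.2, hy, hy0, _,
        hstring i n (by rw [hk, hn]) (by omega) (n - 2) (by omega), ?_, ?_⟩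
      · rw [map_sub, map_smul, hi, map_smul, map_sub, hx, hx0 l hl hlv.1 hlv.2, hcast]
        have h3 : (0 : K) - (k - 2) • k⁻¹ • (0 - 1) = (k - 2) * k⁻¹ := by
          simp only [smul_eq_mul]; ring
        rw [h3]
        exact mul_ne_zero hk2 (inv_ne_zero hk0)
      · rw [map_sub, map_smul, hi, map_smul, map_sub, hy, hvl, hcast]
        simp only [smul_eq_mul]
        field_simp
        ring
  have hyv : y v = 0 := hyd0 v hv hdv hdv'
  have hk' : k⁻¹ ≠ 0 := inv_ne_zero hk0
  rcases hΩ ν hν with h | ⟨ε, -, h | ⟨i, h⟩⟩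
  · exact hxν h
  · rw [h, map_smul, hyv, smul_zero] at hyν
    exact mul_ne_zero two_ne_zero hk' hyν.symm
  · rw [h, map_add, map_smul, hyv, smul_zero, zero_add] at hyν
    rcases hS.dual_root hd hyd hyd0 i with h' | h' | h' <;> rw [h'] at hyν
    · exact mul_ne_zero two_ne_zero hk' hyν.symm
    · exact hk' (by linear_combination -hyν)
    · have : (3 : K) * k⁻¹ = 0 := by linear_combination -hyν
      exact mul_ne_zero three_ne_zero hk' this

end IsScaledFrame

end Scale
end RootPairing

/-! ### Sorting the frame by height. -/

namespace RootPairing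

section Sorted

variable {ι K M N : Type*} [Field K] [CharZero K] [AddCommGroup M] [Module K M]
  [AddCommGroup N] [Module K N] {P : RootPairing ι K M N}

theorem Base.exists_dual_root_eq_height [P.IsRootSystem] (b : P.Base) :
    ∃ f : Dual K M, ∀ i, f (P.root i) = (b.height i : K) := by
  refine ⟨b.toWeightBasis.constr K fun _ ↦ (1 : K), fun i ↦ ?_⟩
  obtain ⟨g, -, -, hg⟩ := b.exists_root_eq_sum_int i
  rw [Base.height_eq_sum hg, hg, map_sum, Int.cast_sum]
  refine Finset.sum_congr rfl fun j hj ↦ ?_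
  have h1 : P.root j = b.toWeightBasis ⟨j, hj⟩ := by simp
  rw [map_zsmul, h1, Basis.constr_basis, zsmul_one]

/-- An enumeration `e` of a scaled frame up to sign, sorted by the heights relative to a base:
`z p` is twice the height of `k⁻¹ • e p`. -/
structure IsSortedFrame (P : RootPairing ι K M N) (b : P.Base) (k : K) {n : ℕ} (e : Fin n → M)
    (z : Fin n → ℤ) : Prop where
  card_support : b.support.card = n
  three_le : 3 ≤ n
  strictAnti : ∀ p q, p < q → z q < z p
  nonneg : ∀ p, 0 ≤ z p
  exists_sub : ∀ p q, p ≠ q → ∃ i, P.root i = k⁻¹ • (e p - e q) ∧ 2 * b.height i = z p - z q ∧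
    ∀ m, P.coroot' i (e m) = if m = p then k else if m = q then -k else 0
  exists_add : ∀ p q, p ≠ q → ∃ i, P.root i = k⁻¹ • (e p + e q) ∧ 2 * b.height i = z p + z q ∧
    ∀ m, P.coroot' i (e m) = if m = p ∨ m = q then k else 0
  exists_of_isPos : ∀ i, b.IsPos i → ∃ p q, p < q ∧
    (P.root i = k⁻¹ • (e p - e q) ∨ P.root i = k⁻¹ • (e p + e q))

namespace IsScaledFrame

variable {v : M} {S : Set M} {k : K} (hS : IsScaledFrame P v S k)
include hS

/-- The factor 2 gives integrality: $2k^{-1}a$ is the sum of the roots $k^{-1}(a-c)$ and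
$k^{-1}(a+c)$. -/
theorem exists_int_height [P.IsRootSystem] [P.IsIrreducible] (b : P.Base) :
    ∃ z : M → ℤ, (∀ a ∈ S, z (-a) = - z a) ∧
      ∀ a ∈ S, ∀ c ∈ S, ∀ i, P.root i = k⁻¹ • (a - c) → 2 * b.height i = z a - z c := by
  obtain ⟨f, hf⟩ := b.exists_dual_root_eq_height
  have hz : ∀ a, ∃ m : ℤ, a ∈ S → f ((2 * k⁻¹) • a) = m := by
    intro a
    by_cases ha : a ∈ S
    · obtain ⟨c, hc, h1, h2⟩ := hS.exists_ne ha
      obtain ⟨i, hi, -⟩ := hS.exists_root ha hc h1 h2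
      obtain ⟨j, hj, -⟩ := hS.exists_root ha (hS.neg_mem hc) h2 (by rwa [neg_neg])
      refine ⟨b.height i + b.height j, fun _ ↦ ?_⟩
      rw [Int.cast_add, ← hf, ← hf, hi, hj, ← map_add]
      congr 1
      module
    · exact ⟨0, fun h ↦ absurd h ha⟩
  choose z hz using hz
  refine ⟨z, fun a ha ↦ ?_, fun a ha c hc i hi ↦ ?_⟩
  · have h1 := hz _ (hS.neg_mem ha)
    rw [smul_neg, map_neg, hz a ha] at h1
    exact_mod_cast h1.symm
  · have h1 : (2 : K) * b.height i = z a - z c := by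
      rw [← hf, hi, ← hz a ha, ← hz c hc, ← smul_eq_mul, ← map_smul, ← map_sub]
      congr 1
      module
    exact_mod_cast h1

/-- Heights of roots are nonzero, so `z` separates frame vectors on different lines. Choosing the
sign with `z ≥ 0` and sorting gives the enumeration. -/
theorem exists_enumeration [Finite ι] [P.IsRootSystem] [P.IsIrreducible] (b : P.Base)
    {z : M → ℤ} (hzneg : ∀ a ∈ S, z (-a) = - z a)
    (hz : ∀ a ∈ S, ∀ c ∈ S, ∀ i, P.root i = k⁻¹ • (a - c) → 2 * b.height i = z a - z c) :
    ∃ (n : ℕ) (e : Fin n → M), (∀ p, e p ∈ S) ∧ (∀ p q, p < q → z (e q) < z (e p)) ∧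
      (∀ p, 0 ≤ z (e p)) ∧ (∀ a ∈ S, ∃ p, a = e p ∨ a = - e p) ∧ ∀ p q, e p ≠ - e q := by
  have hinj : ∀ a ∈ S, ∀ c ∈ S, z a = z c → a = c ∨ a = -c := by
    intro a ha c hc h
    by_contra! hcon
    obtain ⟨i, hi, -⟩ := hS.exists_root ha hc hcon.1 hcon.2
    have h1 := hz a ha c hc i hi
    have h2 := b.height_ne_zero i
    omega
  have hne : ∀ a ∈ S, a ≠ -a := by
    intro a ha h
    refine hS.ne_zero ha ?_
    have h2 : (2 : K) • a = 0 := by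
      rw [two_smul]
      nth_rw 1 [h]
      rw [neg_add_cancel]
    exact (smul_eq_zero.1 h2).resolve_left two_ne_zero
  obtain ⟨T, hTS, hT0, hT, hTneg⟩ : ∃ T ⊆ S, (∀ a ∈ T, 0 ≤ z a) ∧ (∀ a ∈ S, a ∈ T ∨ -a ∈ T) ∧
      ∀ a ∈ T, -a ∉ T := by
    -- At most one pair `±a₀` has height zero, and there the sign is chosen arbitrarily. In type $D$
    -- this is the last vector $\varepsilon_n$.
    by_cases h0 : ∃ a₀ ∈ S, z a₀ = 0
    · obtain ⟨a₀, ha₀, hz₀⟩ := h0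
      refine ⟨{a | a ∈ S ∧ (0 < z a ∨ a = a₀)}, fun a ha ↦ ha.1, ?_, ?_, ?_⟩
      · rintro a ⟨-, h | rfl⟩ <;> omega
      · intro a ha
        have h1 := hzneg a ha
        rcases lt_trichotomy (z a) 0 with h | h | h
        · exact Or.inr ⟨hS.neg_mem ha, Or.inl (by omega)⟩
        · rcases hinj a ha a₀ ha₀ (by omega) with rfl | rfl
          · exact Or.inl ⟨ha, Or.inr rfl⟩
          · exact Or.inr ⟨hS.neg_mem ha, Or.inr (neg_neg _)⟩
        · exact Or.inl ⟨ha, Or.inl h⟩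
      · rintro a ⟨ha, h⟩ ⟨-, h'⟩
        have h1 := hzneg a ha
        rcases h with h | rfl <;> rcases h' with h' | h'
        · omega
        · rw [h'] at h1
          omega
        · omega
        · exact hne _ ha h'.symm
    · push Not at h0
      refine ⟨{a | a ∈ S ∧ 0 < z a}, fun a ha ↦ ha.1, fun a ha ↦ ha.2.le, ?_, ?_⟩
      · intro a ha
        have h1 := hzneg a ha
        have h2 := h0 a ha
        rcases lt_or_gt_of_ne h2 with h | h
        · exact Or.inr ⟨hS.neg_mem ha, by omega⟩
        · exact Or.inl ⟨ha, h⟩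
      · rintro a ⟨ha, h⟩ ⟨-, h'⟩
        have h1 := hzneg a ha
        omega
  have hTne : ∀ a ∈ T, ∀ c ∈ T, a ≠ -c := fun a ha c hc h ↦ hTneg c hc (h ▸ ha)
  have : Module.Finite K M := Module.Finite.of_basis b.toWeightBasis
  have hfin : T.Finite := (hS.linearIndepOn hTS hTne).linearIndependent.setFinite
  -- The minus sign turns the increasing enumeration of `Z` into a decreasing one for `z`.
  set Z : Finset ℤ := hfin.toFinset.image fun a ↦ -z a
  let o := Z.orderIsoOfFin rfl
  have ho : ∀ p, ∃ a ∈ T, -z a = o p := by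
    intro p
    obtain ⟨a, ha, h⟩ := Finset.mem_image.1 (o p).2
    exact ⟨a, by simpa using ha, h⟩
  choose e he heo using ho
  refine ⟨Z.card, e, fun p ↦ hTS (he p), fun p q hpq ↦ ?_, fun p ↦ hT0 _ (he p), ?_,
    fun p q ↦ hTne _ (he p) _ (he q)⟩
  · have h1 : (o p : ℤ) < o q := o.lt_iff_lt.2 hpq
    rw [← heo, ← heo] at h1
    omega
  · have key : ∀ a ∈ T, ∃ p, a = e p := by
      intro a ha
      have hmem : -z a ∈ Z := Finset.mem_image_of_mem _ (by simpa using ha)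
      refine ⟨o.symm ⟨_, hmem⟩, ?_⟩
      have h1 := heo (o.symm ⟨_, hmem⟩)
      rw [OrderIso.apply_symm_apply] at h1
      simp only [neg_inj] at h1
      exact ((hinj _ (hTS (he _)) a (hTS ha) h1).resolve_right (hTne _ (he _) _ ha)).symm
    intro a ha
    rcases hT a ha with h | h
    · obtain ⟨p, hp⟩ := key a h
      exact ⟨p, Or.inl hp⟩
    · obtain ⟨p, hp⟩ := key _ h
      exact ⟨p, Or.inr (by rw [← hp, neg_neg])⟩

/-- Every scaled frame can be sorted with respect to a given base. -/
theorem exists_isSortedFrame [Finite ι] [P.IsRootSystem] [P.IsReduced] [P.IsIrreducible]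
    (b : P.Base) : ∃ (n : ℕ) (e : Fin n → M) (z : Fin n → ℤ), IsSortedFrame P b k e z ∧
      (∀ p, e p ∈ S) ∧ ∀ a ∈ S, ∃ p, a = e p ∨ a = - e p := by
  obtain ⟨z, hzneg, hz⟩ := hS.exists_int_height b
  obtain ⟨n, e, heS, hlt, h0, hcov, hneg⟩ := hS.exists_enumeration b hzneg hz
  have hne : ∀ p q, p ≠ q → e p ≠ e q := by
    intro p q hpq h
    rcases lt_or_gt_of_ne hpq with h' | h' <;> have := hlt _ _ h' <;> rw [h] at this <;> omega
  refine ⟨n, e, fun p ↦ z (e p), ⟨?_, ?_, hlt, h0, ?_, ?_, ?_⟩, heS, hcov⟩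
  · have hx (p : Fin n) := hS.exists_dual (heS p)
    choose x hx hx0 using hx
    have hli : LinearIndependent K e := LinearIndependent.of_pairwise_dual_eq_zero_one _ x
      (fun p q hpq ↦ hx0 p _ (heS q) (hne _ _ hpq.symm) (hneg _ _)) hx
    have hspan : ⊤ ≤ Submodule.span K (Set.range e) := by
      rw [← hS.span_eq_top]
      refine Submodule.span_le.2 fun a ha ↦ ?_
      obtain ⟨p, rfl | rfl⟩ := hcov a ha
      · exact Submodule.subset_span ⟨p, rfl⟩
      · exact Submodule.neg_mem _ (Submodule.subset_span ⟨p, rfl⟩)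
    have h1 := Module.finrank_eq_card_basis (Basis.mk hli hspan)
    have h2 := Module.finrank_eq_card_basis b.toWeightBasis
    rw [h1] at h2
    simpa using h2.symm
  · have hv := hS.base_mem
    obtain ⟨c, hc, h1, h2⟩ := hS.exists_ne hv
    obtain ⟨d, hd, h3, h4, h5, h6⟩ := hS.exists_third hv hc h1 h2
    obtain ⟨p₁, hp₁⟩ := hcov _ hv
    obtain ⟨p₂, hp₂⟩ := hcov _ hc
    obtain ⟨p₃, hp₃⟩ := hcov _ hd
    have e1 : p₁ ≠ p₂ := by
      rintro rfl
      rcases hp₁ with hp₁ | hp₁ <;> rcases hp₂ with hp₂ | hp₂ <;> rw [hp₁, hp₂] at h1 h2 <;>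
        simp at h1 h2
    have e2 : p₃ ≠ p₁ := by
      rintro rfl
      rcases hp₁ with hp₁ | hp₁ <;> rcases hp₃ with hp₃ | hp₃ <;> rw [hp₁, hp₃] at h3 h4 <;>
        simp at h3 h4
    have e3 : p₃ ≠ p₂ := by
      rintro rfl
      rcases hp₂ with hp₂ | hp₂ <;> rcases hp₃ with hp₃ | hp₃ <;> rw [hp₂, hp₃] at h5 h6 <;>
        simp at h5 h6
    rw [ne_eq, Fin.ext_iff] at e1 e2 e3
    omega
  · intro p q hpq
    obtain ⟨i, hi, h1, h2, h3⟩ := hS.exists_root (heS p) (heS q) (hne _ _ hpq) (hneg _ _)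
    refine ⟨i, hi, hz _ (heS p) _ (heS q) i hi, fun m ↦ ?_⟩
    split_ifs with hmp hmq
    · rw [hmp, h1]
    · rw [hmq, h2]
    · exact h3 _ (heS m) (hne _ _ hmp) (hneg _ _) (hne _ _ hmq) (hneg _ _)
  · intro p q hpq
    obtain ⟨i, hi, h1, h2, h3⟩ := hS.exists_root (heS p) (hS.neg_mem (heS q)) (hneg _ _)
      (by rw [neg_neg]; exact hne _ _ hpq)
    refine ⟨i, by rw [hi, sub_neg_eq_add], ?_, fun m ↦ ?_⟩
    · rw [hz _ (heS p) _ (hS.neg_mem (heS q)) i hi, hzneg _ (heS q), sub_neg_eq_add]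
    · split_ifs with hm
      · rcases hm with rfl | rfl
        · exact h1
        · rw [map_neg, neg_inj] at h2
          exact h2
      · push Not at hm
        exact h3 _ (heS m) (hne _ _ hm.1) (hneg _ _) (hneg _ _) (by
          rw [neg_neg]; exact hne _ _ hm.2)
  · intro i hi
    rw [Base.isPos_iff] at hi
    obtain ⟨a, ha, c, hc, h1, h2, hr⟩ := hS.exists_root_eq i
    have hh := hz a ha c hc i hr
    obtain ⟨p, hp⟩ := hcov a ha
    obtain ⟨q, hq⟩ := hcov c hc
    have hpq : p ≠ q := by
      rintro rfl
      rcases hp with hp | hp <;> rcases hq with hq | hq <;> rw [hp, hq] at h1 h2 <;>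
        simp at h1 h2
    have hp0 := h0 p
    have hq0 := h0 q
    rcases hp with rfl | rfl <;> rcases hq with rfl | rfl
    · refine ⟨p, q, ?_, Or.inl hr⟩
      by_contra hlt'
      have := hlt q p (lt_of_le_of_ne (not_lt.1 hlt') hpq.symm)
      omega
    · rw [sub_neg_eq_add] at hr
      rcases lt_or_gt_of_ne hpq with h | h
      · exact ⟨p, q, h, Or.inr hr⟩
      · exact ⟨q, p, h, Or.inr (by rw [hr, add_comm])⟩
    · rw [hzneg _ (heS p)] at hh
      omega
    · rw [hzneg _ (heS p), hzneg _ (heS q)] at hh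
      refine ⟨q, p, ?_, Or.inl (by rw [hr, neg_sub_neg])⟩
      by_contra hlt'
      have := hlt p q (lt_of_le_of_ne (not_lt.1 hlt') hpq)
      omega

end IsScaledFrame

end Sorted
end RootPairing

/-! ### Recognising type $D$ and the dominant vector. -/

namespace RootPairing

section TypeD

variable {ι K M N : Type*} [Field K] [CharZero K] [AddCommGroup M] [Module K M]
  [AddCommGroup N] [Module K N] {P : RootPairing ι K M N}

namespace IsSortedFrame

variable {b : P.Base} {k : K} {n : ℕ} {e : Fin n → M} {z : Fin n → ℤ}
  (h : IsSortedFrame P b k e z)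
include h

theorem scale_ne_zero : k ≠ 0 := by
  have h3 := h.three_le
  obtain ⟨i, hi, -⟩ := h.exists_sub ⟨0, by omega⟩ ⟨1, by omega⟩ (by simp)
  rintro rfl
  exact P.ne_zero i (by rw [hi, inv_zero, zero_smul])

theorem two_le_sub {p q : Fin n} (hpq : p < q) : 2 ≤ z p - z q := by
  obtain ⟨i, -, hi, -⟩ := h.exists_sub p q hpq.ne
  have := h.strictAnti p q hpq
  omega

/-- The simple roots, numbered as in type `D`. -/
theorem exists_simple : ∃ (r : Fin n → ι) (c : Fin n → Fin n → ℤ),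
    (∀ p q, P.coroot' (r p) (e q) = k * c p q) ∧
    (∀ p q : Fin n, (p : ℕ) + 1 = q → P.root (r p) = k⁻¹ • (e p - e q)) ∧
    (∀ p q : Fin n, (p : ℕ) + 2 = n → (q : ℕ) + 1 = n → P.root (r q) = k⁻¹ • (e p + e q)) ∧
    (∀ p q : Fin n, (p : ℕ) + 1 < n → c p q = if (q : ℕ) = p then 1 else
      if (q : ℕ) = p + 1 then -1 else 0) ∧
    (∀ p q : Fin n, (p : ℕ) + 1 = n → c p q = if (q : ℕ) + 2 = n ∨ (q : ℕ) + 1 = n then 1 else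
      0) := by
  have h3 := h.three_le
  have key : ∀ p : Fin n, ∃ (i : ι) (c : Fin n → ℤ),
      (∀ q, P.coroot' i (e q) = k * c q) ∧
      (∀ q : Fin n, (p : ℕ) + 1 = q → P.root i = k⁻¹ • (e p - e q)) ∧
      (∀ q : Fin n, (q : ℕ) + 2 = n → (p : ℕ) + 1 = n → P.root i = k⁻¹ • (e q + e p)) ∧
      (∀ q : Fin n, (p : ℕ) + 1 < n → c q = if (q : ℕ) = p then 1 else
        if (q : ℕ) = p + 1 then -1 else 0) ∧
      (∀ q : Fin n, (p : ℕ) + 1 = n → c q = if (q : ℕ) + 2 = n ∨ (q : ℕ) + 1 = n then 1 else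
        0) := by
    intro p
    by_cases hp : (p : ℕ) + 1 < n
    · obtain ⟨i, hi, -, hc⟩ := h.exists_sub p ⟨p + 1, hp⟩ (by simp [Fin.ext_iff])
      refine ⟨i, fun q ↦ if (q : ℕ) = p then 1 else if (q : ℕ) = p + 1 then -1 else 0,
        fun q ↦ ?_, fun q hq ↦ ?_, fun q _ hp' ↦ by omega, fun q _ ↦ rfl, fun q hp' ↦ by omega⟩
      · simp only [hc, Fin.ext_iff]
        split_ifs <;> simp
      · rw [hi, show q = ⟨p + 1, hp⟩ from Fin.ext hq.symm]
    · have hp' : (p : ℕ) + 1 = n := by omega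
      obtain ⟨i, hi, -, hc⟩ := h.exists_add ⟨n - 2, by omega⟩ p (by simp [Fin.ext_iff]; omega)
      refine ⟨i, fun q ↦ if (q : ℕ) + 2 = n ∨ (q : ℕ) + 1 = n then 1 else 0,
        fun q ↦ ?_, fun q hq ↦ by omega, fun q hq _ ↦ ?_, fun q _ ↦ by omega, fun q _ ↦ rfl⟩
      · simp only [hc, Fin.ext_iff]
        split_ifs <;> first | omega | simp
      · rw [hi, show q = ⟨n - 2, by omega⟩ from Fin.ext (by simp; omega)]
  choose r c hc h1 h2 h4 h5 using key
  exact ⟨r, c, hc, h1, fun p q hp hq ↦ h2 q p hp hq, h4, h5⟩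

/-- A simple root is one of the roots of the standard fundamental system of type `D`. -/
theorem exists_eq_of_mem_support {s : ι} (hs : s ∈ b.support) :
    (∃ p q : Fin n, (p : ℕ) + 1 = q ∧ P.root s = k⁻¹ • (e p - e q)) ∨
      ∃ p q : Fin n, (p : ℕ) + 2 = n ∧ (q : ℕ) + 1 = n ∧ P.root s = k⁻¹ • (e p + e q) := by
  have h3 := h.three_le
  have hheight := b.height_one_of_mem_support hs
  obtain ⟨p, q, hpq, hr | hr⟩ := h.exists_of_isPos s (b.isPos_of_mem_support hs)
  · refine Or.inl ⟨p, q, ?_, hr⟩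
    obtain ⟨i, hi, hz, -⟩ := h.exists_sub p q hpq.ne
    rw [P.root.injective (hi.trans hr.symm), hheight] at hz
    -- Height one means `z p - z q = 2`; an index strictly between would contribute two gaps of at
    -- least 2.
    by_contra hne
    have h1 := h.two_le_sub (p := p) (q := ⟨p + 1, by omega⟩) (by simp [Fin.lt_def])
    have h2 := h.two_le_sub (p := ⟨p + 1, by omega⟩) (q := q)
      (by rw [Fin.lt_def] at hpq ⊢; simp only; omega)
    omega
  · refine Or.inr ⟨p, q, ?_⟩
    obtain ⟨i, hi, hz, -⟩ := h.exists_add p q hpq.ne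
    rw [P.root.injective (hi.trans hr.symm), hheight] at hz
    have hq0 := h.nonneg q
    have h0 := h.two_le_sub hpq
    -- Here `z p + z q = 2` with `z p - z q ≥ 2` and `z q ≥ 0`, so `z q = 0` and `z p = 2`: nothing
    -- fits below `q` or between `p` and `q`.
    have hq : (q : ℕ) + 1 = n := by
      by_contra hne
      have h1 := h.two_le_sub (p := q) (q := ⟨n - 1, by omega⟩)
        (by rw [Fin.lt_def]; simp only; omega)
      have h2 := h.nonneg ⟨n - 1, by omega⟩
      omega
    refine ⟨?_, hq, hr⟩
    by_contra hne
    rw [Fin.lt_def] at hpq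
    have h1 := h.two_le_sub (p := p) (q := ⟨n - 2, by omega⟩)
      (by rw [Fin.lt_def]; simp only; omega)
    have h2 := h.two_le_sub (p := ⟨n - 2, by omega⟩) (q := q)
      (by rw [Fin.lt_def]; simp only; omega)
    omega

/-- Every simple root is among the `n` standard ones, and there are `n` simple roots, so the two
lists coincide by counting. -/
theorem exists_numbering [P.IsCrystallographic] : ∃ E : Fin n ≃ b.support,
    (∀ i j, b.cartanMatrix (E i) (E j) = CartanMatrix.D n i j) ∧
    ∀ (i j : Fin n), (i : ℕ) = 0 → P.coroot' (E j) (e i) = if j = i then k else 0 := by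
  have h3 := h.three_le
  have hk := h.scale_ne_zero
  obtain ⟨r, c, hc, hsub, hadd, hc1, hc2⟩ := h.exists_simple
  have hsurj : ∀ s : b.support, ∃ p, r p = s := by
    rintro ⟨s, hs⟩
    rcases h.exists_eq_of_mem_support hs with ⟨p, q, hpq, hr⟩ | ⟨p, q, hp, hq, hr⟩
    · exact ⟨p, P.root.injective ((hsub p q hpq).trans hr.symm)⟩
    · exact ⟨q, P.root.injective ((hadd p q hp hq).trans hr.symm)⟩
  choose g hg using hsurj
  have hginj : Function.Injective g := fun s t hst ↦ Subtype.ext (by rw [← hg s, ← hg t, hst])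
  have hgbij : Function.Bijective g :=
    (Fintype.bijective_iff_injective_and_card g).2 ⟨hginj, by simp [h.card_support]⟩
  let E := (Equiv.ofBijective g hgbij).symm
  have hE : ∀ p, (E p : ι) = r p := by
    intro p
    rw [← hg (E p)]
    exact congrArg r ((Equiv.ofBijective g hgbij).apply_symm_apply p)
  refine ⟨E, fun p q ↦ ?_, fun i j hi ↦ ?_⟩
  · have hcast : ((b.cartanMatrix (E p) (E q) : ℤ) : K) = P.coroot' (r q) (P.root (r p)) := by
      rw [root_coroot'_eq_pairing, ← hE, ← hE]
      exact b.algebraMap_cartanMatrixIn_apply ℤ (E p) (E q)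
    by_cases hp : (p : ℕ) + 1 < n
    · have hval : P.coroot' (r q) (P.root (r p)) = ((c q p - c q ⟨p + 1, hp⟩ : ℤ) : K) := by
        rw [hsub p ⟨p + 1, hp⟩ rfl, map_smul, map_sub, hc, hc, smul_eq_mul]
        push_cast
        field_simp
      rw [hval] at hcast
      rw [Int.cast_injective hcast]
      simp only [CartanMatrix.D, Matrix.of_apply, Fin.ext_iff]
      by_cases hq : (q : ℕ) + 1 < n
      · rw [hc1 q p hq, hc1 q _ hq]
        simp only
        omega
      · rw [hc2 q p (by omega), hc2 q _ (by omega)]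
        simp only
        omega
    · have hval : P.coroot' (r q) (P.root (r p)) = ((c q ⟨n - 2, by omega⟩ + c q p : ℤ) : K) := by
        rw [hadd ⟨n - 2, by omega⟩ p (by simp only; omega) (by omega), map_smul, map_add, hc, hc,
          smul_eq_mul]
        push_cast
        field_simp
      rw [hval] at hcast
      rw [Int.cast_injective hcast]
      simp only [CartanMatrix.D, Matrix.of_apply, Fin.ext_iff]
      by_cases hq : (q : ℕ) + 1 < n
      · rw [hc1 q p hq, hc1 q _ hq]
        simp only
        omega
      · rw [hc2 q p (by omega), hc2 q _ (by omega)]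
        simp only
        omega
  · rw [hE, hc]
    by_cases hj : (j : ℕ) + 1 < n
    · rw [hc1 j i hj]
      simp only [Fin.ext_iff]
      split_ifs <;> first | omega | simp
    · rw [hc2 j i (by omega)]
      simp only [Fin.ext_iff]
      split_ifs <;> first | omega | simp

/-- A dominant vector of a sorted frame is the first one. -/
theorem eq_of_dominant {m : ℕ} (hm : k = m) {l : M}
    (hdom : ∀ i, b.IsPos i → ∃ t : ℕ, P.coroot' i l = t) {p : Fin n} (hl : l = e p ∨ l = - e p) :
    l = e p ∧ (p : ℕ) = 0 := by
  have h3 := h.three_le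
  have hk := h.scale_ne_zero
  have hneg : ∀ t : ℕ, -k ≠ t := by
    intro t ht
    rw [hm, neg_eq_iff_add_eq_zero] at ht
    norm_cast at ht
    exact hk (by rw [hm, (by omega : m = 0), Nat.cast_zero])
  -- In each wrong case a positive root has coroot value `-k` at `l`: take
  -- $\varepsilon_1-\varepsilon_p$ if `l = e p` is not the first vector, and
  -- $\varepsilon_p+\varepsilon_q$ if `l = -e p`.
  rcases hl with rfl | rfl
  · refine ⟨rfl, ?_⟩
    by_contra hp
    have hlt : (⟨0, by omega⟩ : Fin n) < p := by rw [Fin.lt_def]; simp only; omega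
    obtain ⟨i, -, hi, hc⟩ := h.exists_sub _ p hlt.ne
    have := h.two_le_sub hlt
    obtain ⟨t, ht⟩ := hdom i (by rw [Base.isPos_iff]; omega)
    rw [hc, if_neg hlt.ne', if_pos rfl] at ht
    exact hneg t ht
  · exfalso
    obtain ⟨q, hq⟩ : ∃ q : Fin n, p ≠ q := by
      by_cases hp : (p : ℕ) = 0
      · exact ⟨⟨1, by omega⟩, by rw [ne_eq, Fin.ext_iff]; simp only; omega⟩
      · exact ⟨⟨0, by omega⟩, by rw [ne_eq, Fin.ext_iff]; simp only; omega⟩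
    obtain ⟨i, -, hi, hc⟩ := h.exists_add p q hq
    have h1 := h.nonneg p
    have h2 := h.nonneg q
    have h4 := b.height_ne_zero i
    obtain ⟨t, ht⟩ := hdom i (by rw [Base.isPos_iff]; omega)
    rw [map_neg, hc, if_pos (Or.inl rfl)] at ht
    exact hneg t ht

end IsSortedFrame

/-- Let `Ω` be a set of vectors containing the root strings below `l`, all of whose elements outside
`ker x` are of the form `±v` or `±v` plus a root, where `±v` are the only members of the signed
Weyl orbit outside `ker x`. If `v` is not proportional to a root and the dominant vector `l` lies in
the orbit, then the root system has type `D` and `l` is `ω₁` or `2ω₁`. -/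
theorem exists_numbering_typeD [Finite ι] [P.IsRootSystem] [P.IsReduced] [P.IsIrreducible]
    [P.IsCrystallographic] (b : P.Base) {v l : M} {x : Dual K M} {Ω : Set M}
    (hv : ∀ (i : ι) (t : K), v ≠ t • P.root i) (hx : x v = 1)
    (hx0 : ∀ a ∈ SignedOrbit P v, a ≠ v → a ≠ -v → x a = 0) (hl : l ∈ SignedOrbit P v)
    (hdom : ∀ i, b.IsPos i → ∃ m : ℕ, P.coroot' i l = m)
    (hstring : ∀ i, ∀ m : ℕ, P.coroot' i l = m → 0 < m → ∀ j ≤ m, l - (j : K) • P.root i ∈ Ω)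
    (hΩ : ∀ ν ∈ Ω, x ν = 0 ∨ ∃ ε : K, (ε = 1 ∨ ε = -1) ∧
      (ν = ε • v ∨ ∃ i, ν = ε • v + P.root i)) :
    ∃ (n : ℕ) (E : Fin n ≃ b.support) (k : K), 3 ≤ n ∧ (k = 1 ∨ k = 2) ∧
      (∀ i j, b.cartanMatrix (E i) (E j) = CartanMatrix.D n i j) ∧
      ∀ j : Fin n, P.coroot' (E j) l = if (j : ℕ) = 0 then k else 0 := by
  have hS := isSignedFrame_signedOrbit P hv x hx hx0
  -- The scale is, up to sign, the value of a positive coroot at the dominant vector `l`, hence may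
  -- be taken to be a natural number.
  obtain ⟨k, m, hk, hS⟩ : ∃ (k : K) (m : ℕ), k = m ∧ IsScaledFrame P v (SignedOrbit P v) k := by
    obtain ⟨k, hk⟩ := hS.exists_scale
    have hS' : IsScaledFrame P v (SignedOrbit P v) k := ⟨hS, hk⟩
    obtain ⟨a, ha, h1, h2⟩ := hS'.exists_ne hl
    obtain ⟨i, -, hi, -⟩ := hS'.exists_root hl ha h1 h2
    let _ := P.indexNeg
    rcases Base.IsPos.or_neg b i with hpos | hpos
    · obtain ⟨m, hm⟩ := hdom i hpos
      exact ⟨k, m, by rw [← hm, hi], hS'⟩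
    · obtain ⟨m, hm⟩ := hdom _ hpos
      refine ⟨-k, m, ?_, hS'.negScale⟩
      rw [← hm, ← hi, indexNeg_neg, ReflectsTo.coroot'_reflectionPerm_self]
  obtain ⟨n, e, z, he, heS, hcov⟩ := hS.exists_isSortedFrame b
  obtain ⟨p, hp⟩ := hcov l hl
  obtain ⟨rfl, hp0⟩ := he.eq_of_dominant hk hdom hp
  obtain ⟨E, hE, hE0⟩ := he.exists_numbering
  have hm2 := hS.natCast_scale_le_two hk hl hx hx0 hstring hΩ
  have hm0 : m ≠ 0 := fun h0 ↦ he.scale_ne_zero (by rw [hk, h0, Nat.cast_zero])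
  refine ⟨n, E, k, he.three_le, ?_, hE, fun j ↦ ?_⟩
  · obtain rfl | rfl : m = 1 ∨ m = 2 := by omega
    · exact Or.inl (by rw [hk, Nat.cast_one])
    · exact Or.inr (by rw [hk, Nat.cast_ofNat])
  · simp only [hE0 p j hp0, Fin.ext_iff, hp0]

end TypeD
end RootPairing

/-! ### Highest weights and root strings. -/

namespace OrthRep

section HighestWeight

variable {𝔤 : Type*} [LieRing 𝔤] [LieAlgebra ℂ 𝔤] [FiniteDimensional ℂ 𝔤] [LieAlgebra.IsKilling ℂ 𝔤]
  {𝔱 : LieSubalgebra ℂ 𝔤} [𝔱.IsCartanSubalgebra]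
  {V : Type*} [AddCommGroup V] [Module ℂ V] {B : LinearMap.BilinForm ℂ V} {κ : 𝔤 →ₗ⁅ℂ⁆ so B}

theorem coe_map_lie_apply (κ : 𝔤 →ₗ⁅ℂ⁆ so B) (x y : 𝔤) (v : V) :
    (κ ⁅x, y⁆ : Module.End ℂ V) v =
      (κ x : Module.End ℂ V) ((κ y : Module.End ℂ V) v) -
        (κ y : Module.End ℂ V) ((κ x : Module.End ℂ V) v) := by
  rw [LieHom.map_lie]
  rfl

/-- Root vectors shift weights. -/
theorem map_apply_of_mem_rootSpace {v : V} {μ : Dual ℂ 𝔱}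
    (hv : ∀ t : 𝔱, (κ (t : 𝔤) : Module.End ℂ V) v = μ t • v) {α : Dual ℂ 𝔱} {x : 𝔤}
    (hx : x ∈ LieAlgebra.rootSpace 𝔱 α) (t : 𝔱) :
    (κ (t : 𝔤) : Module.End ℂ V) ((κ x : Module.End ℂ V) v) =
      (μ + α) t • (κ x : Module.End ℂ V) v := by
  have h := coe_map_lie_apply κ (t : 𝔤) x v
  rw [← LieSubalgebra.coe_bracket_of_module, LieAlgebra.IsKilling.lie_eq_smul_of_mem_rootSpace hx t, map_smul, hv, map_smul] at h
  rw [eq_sub_iff_add_eq] at h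
  rw [← h, LinearMap.add_apply, add_smul, add_comm]
  rfl

/-- The height, extended to a linear functional, is nonnegative on `l` minus any weight, but would
be negative on minus a positive root. -/
theorem apply_mem_of_isHighestWeight {b : (rootSys 𝔱).Base} {l : Dual ℂ 𝔱}
    (hl : IsHighestWeight κ b l) {i : 𝔱.root} (hi : b.IsPos i) :
    l + (rootSys 𝔱).root i ∉ weights κ 𝔱 := by
  intro hmem
  obtain ⟨f, hf⟩ := b.exists_dual_root_eq_height
  have h1 : ∀ y ∈ AddSubmonoid.closure ((rootSys 𝔱).root '' b.support), ∃ m : ℕ, f y = m := by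
    intro y hy
    induction hy using AddSubmonoid.closure_induction with
    | mem y hy =>
      obtain ⟨j, hj, rfl⟩ := hy
      exact ⟨1, by rw [hf, b.height_one_of_mem_support hj]; simp⟩
    | zero => exact ⟨0, by simp⟩
    | add y y' _ _ h h' =>
      obtain ⟨m, hm⟩ := h
      obtain ⟨m', hm'⟩ := h'
      exact ⟨m + m', by rw [map_add, hm, hm']; push_cast; rfl⟩
  obtain ⟨m, hm⟩ := h1 _ (hl.2 _ hmem)
  rw [sub_add_cancel_left, map_neg, hf] at hm
  have h2 : -b.height i = (m : ℤ) := by exact_mod_cast hm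
  rw [RootPairing.Base.isPos_iff] at hi
  omega

/-- The highest weight is dominant and integral, and the root strings below it consist of weights. -/
theorem exists_nat_of_isHighestWeight [FiniteDimensional ℂ V] {b : (rootSys 𝔱).Base}
    {l : Dual ℂ 𝔱} (hl : IsHighestWeight κ b l) {i : 𝔱.root} (hi : b.IsPos i) :
    ∃ n : ℕ, l ((rootSys 𝔱).coroot i) = n ∧
      ∀ j ≤ n, l - (j : ℂ) • (rootSys 𝔱).root i ∈ weights κ 𝔱 := by
  let _ : LieRingModule 𝔤 V := LieRingModule.compLieHom V ((so B).incl.comp κ)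
  have : LieModule ℂ 𝔤 V := LieModule.compLieHom V ((so B).incl.comp κ)
  have hlie : ∀ (x : 𝔤) (v : V), ⁅x, v⁆ = (κ x : Module.End ℂ V) v := fun _ _ ↦ rfl
  have hi0 := LieSubalgebra.isNonZero_coe_root i
  obtain ⟨h, e, f, t, he, hf⟩ := LieAlgebra.IsKilling.exists_isSl2Triple_of_weight_isNonZero hi0
  have hh := t.h_eq_coroot hi0 he hf
  obtain ⟨v, hv0, hv⟩ := hl.1
  have hprim : t.HasPrimitiveVectorWith v (l ((rootSys 𝔱).coroot i)) := by
    refine ⟨hv0, by rw [hh]; exact hv _, ?_⟩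
    by_contra hne
    exact apply_mem_of_isHighestWeight hl hi
      ⟨_, hne, map_apply_of_mem_rootSpace (α := (rootSys 𝔱).root i) hv he⟩
  obtain ⟨n, hn⟩ := hprim.exists_nat
  refine ⟨n, hn, fun j hj ↦ ⟨_, hprim.pow_toEnd_f_ne_zero_of_eq_nat hn hj, ?_⟩⟩
  clear hj
  induction j with
  | zero => simpa using hv
  | succ j ih =>
    intro s
    rw [pow_succ', Module.End.mul_apply, LieModule.toEnd_apply_apply, hlie]
    rw [map_apply_of_mem_rootSpace (α := -(rootSys 𝔱).root i) ih hf]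
    congr 2
    push_cast
    module

/-- A positive value at `l` forces the root to be positive: otherwise its negative is positive and
would have a negative value at the dominant weight. -/
theorem coroot_apply_eq_natCast [FiniteDimensional ℂ V] {b : (rootSys 𝔱).Base}
    {l : Dual ℂ 𝔱} (hl : IsHighestWeight κ b l) (i : 𝔱.root) {m : ℕ}
    (hm : l ((rootSys 𝔱).coroot i) = m) (hm0 : 0 < m) {j : ℕ} (hj : j ≤ m) :
    l - (j : ℂ) • (rootSys 𝔱).root i ∈ weights κ 𝔱 := by
  have hi : b.IsPos i := by
    let _ := (rootSys 𝔱).indexNeg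
    refine (RootPairing.Base.IsPos.or_neg b i).resolve_right fun hneg ↦ ?_
    obtain ⟨n, hn, -⟩ := exists_nat_of_isHighestWeight hl hneg
    rw [RootPairing.indexNeg_neg] at hn
    have h1 := RootPairing.ReflectsTo.coroot'_reflectionPerm_self (rootSys 𝔱) i l
    change l _ = - l _ at h1
    rw [h1, hm, neg_eq_iff_add_eq_zero] at hn
    norm_cast at hn
    omega
  obtain ⟨n, hn, hstr⟩ := exists_nat_of_isHighestWeight hl hi
  rw [hm, Nat.cast_inj] at hn
  exact hstr j (hn ▸ hj)

end HighestWeight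

end OrthRep

/-! ### The functional cut out by the hyperplane. -/

namespace RootPairing

variable {ι K M N : Type*} [Field K] [CharZero K] [AddCommGroup M] [Module K M]
  [AddCommGroup N] [Module K N] {P : RootPairing ι K M N}

theorem nonempty_of_isIrreducible (P : RootPairing ι K M N) [P.IsRootSystem] [P.IsIrreducible] :
    Nonempty ι := by
  by_contra hne
  rw [not_nonempty_iff] at hne
  have h := IsRootSystem.span_root_eq_top (P := P)
  rw [Set.range_eq_empty, Submodule.span_empty] at h
  have := IsIrreducible.nontrivial (P := P)
  exact bot_ne_top h

/-- A reflected vector and its negative both lie in `U`, so their midpoint $0$ does, and `U` is a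
linear subspace. Were `v` in it, the whole orbit would be, and the orbit spans by irreducibility. -/
theorem exists_dual_of_signedOrbit_subset [P.IsRootSystem] [P.IsIrreducible] {v : M}
    (hv : ∀ (i : ι) (t : K), v ≠ t • P.root i) {U : AffineSubspace K M} (hU : U.direction ≠ ⊤)
    (h : ∀ a ∈ SignedOrbit P v, a ≠ v → a ≠ -v → a ∈ U) :
    ∃ x : Dual K M, x v = 1 ∧ ∀ u ∈ U, x u = 0 := by
  have hv0 : v ≠ 0 := by
    rintro rfl
    obtain ⟨i⟩ := nonempty_of_isIrreducible P
    exact hv i 0 (zero_smul _ _).symm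
  obtain ⟨i, hi⟩ : ∃ i, P.coroot' i v ≠ 0 := by
    by_contra! hcon
    exact hv0 ((eq_zero_iff_forall_coroot'_eq_zero P).2 hcon)
  have h1 := IsSignedFrame.reflection_ne hi
  have h2 := IsSignedFrame.reflection_ne_neg_of_ne_smul (hv i)
  have hw : P.reflection i v ∈ U := h _ (.reflection i .base) h1 h2
  have hw' : -P.reflection i v ∈ U := h _ (.neg (.reflection i .base))
    (fun h ↦ h2 (neg_eq_iff_eq_neg.1 h)) (fun h ↦ h1 (neg_injective h))
  have h0 : (0 : M) ∈ U := by
    have h3 := Submodule.smul_mem _ (2⁻¹ : K) (AffineSubspace.vsub_mem_direction hw' hw)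
    have h4 := AffineSubspace.vadd_mem_of_mem_direction h3 hw
    convert h4 using 1
    rw [vsub_eq_sub, vadd_eq_add]
    module
  have hdir : ∀ u ∈ U, u ∈ U.direction := by
    intro u hu
    simpa using AffineSubspace.vsub_mem_direction hu h0
  have hvU : v ∉ U.direction := by
    intro hvU
    refine hU (top_le_iff.1 ?_)
    rw [← span_eq_top_of_reflection_mem (P := P) (SignedOrbit P v) .base hv0
      fun i a ha ↦ Submodule.subset_span (.reflection i ha)]
    refine Submodule.span_le.2 fun a ha ↦ ?_
    by_cases e1 : a = v
    · rwa [e1]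
    by_cases e2 : a = -v
    · rw [e2]
      exact Submodule.neg_mem _ hvU
    exact hdir a (h a ha e1 e2)
  obtain ⟨f, hf, hfU⟩ := Submodule.exists_le_ker_of_notMem hvU
  exact ⟨(f v)⁻¹ • f, by simp [hf], fun u hu ↦ by
    have : f u = 0 := hfU (hdir u hu)
    simp [this]⟩

theorem smul_mem_signedOrbit (w : P.weylGroup) {v a : M} (ha : a ∈ SignedOrbit P v) :
    w • a ∈ SignedOrbit P v := by
  obtain ⟨w, hw⟩ := w
  induction hw using weylGroup.induction generalizing a with
  | mem i => exact .reflection i ha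
  | one => exact (one_smul P.weylGroup a).symm ▸ ha
  | mul x y hx hy h1 h2 =>
    exact (mul_smul (⟨x, hx⟩ : P.weylGroup) ⟨y, hy⟩ a).symm ▸ h1 (h2 ha)

end RootPairing

/-! ### Transport of weights along the Weyl group and automorphisms. -/

namespace OrthRep

section Transport

variable {𝔤 : Type*} [LieRing 𝔤] [LieAlgebra ℂ 𝔤] [FiniteDimensional ℂ 𝔤] [LieAlgebra.IsKilling ℂ 𝔤]
  {𝔱 : LieSubalgebra ℂ 𝔤} [𝔱.IsCartanSubalgebra]
  {V : Type*} [AddCommGroup V] [Module ℂ V] {B : LinearMap.BilinForm ℂ V} {κ : 𝔤 →ₗ⁅ℂ⁆ so B}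

theorem IsExtremalWeight.smul {μ : Dual ℂ 𝔱} (h : IsExtremalWeight κ μ)
    (w : (rootSys 𝔱).weylGroup) : IsExtremalWeight κ (w • μ) := by
  obtain ⟨b, l, hl, w', rfl⟩ := h
  exact ⟨b, l, hl, w * w', (mul_smul _ _ _).symm⟩

theorem IsExtremalWeight.of_mem_signedOrbit {μ a : Dual ℂ 𝔱} (h : IsExtremalWeight κ μ)
    (h' : IsExtremalWeight κ (-μ)) (ha : a ∈ RootPairing.SignedOrbit (rootSys 𝔱) μ) :
    IsExtremalWeight κ a := by
  suffices IsExtremalWeight κ a ∧ IsExtremalWeight κ (-a) from this.1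
  induction ha with
  | base => exact ⟨h, h'⟩
  | neg _ ih => exact ⟨ih.2, by rw [neg_neg]; exact ih.1⟩
  | reflection i _ ih =>
    refine ⟨ih.1.smul (RootPairing.weylGroup.ofIdx (rootSys 𝔱) i), ?_⟩
    rw [← map_neg]
    exact ih.2.smul (RootPairing.weylGroup.ofIdx (rootSys 𝔱) i)

theorem mem_signedOrbit_of_smul {l : Dual ℂ 𝔱} (w : (rootSys 𝔱).weylGroup) :
    l ∈ RootPairing.SignedOrbit (rootSys 𝔱) (w • l) := by
  have := RootPairing.smul_mem_signedOrbit w⁻¹ (.base (P := rootSys 𝔱) (v := w • l))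
  rwa [inv_smul_smul] at this

theorem IsIrreducible.comp_equiv (h : IsIrreducible κ) (σ : 𝔤 ≃ₗ⁅ℂ⁆ 𝔤) :
    IsIrreducible (κ.comp (σ : 𝔤 →ₗ⁅ℂ⁆ 𝔤)) := by
  refine ⟨h.1, fun W hW ↦ h.2 W fun x v hv ↦ ?_⟩
  have := hW (σ.symm x) v hv
  rwa [LieHom.comp_apply, LieEquiv.coe_toLieHom, LieEquiv.apply_symm_apply] at this

theorem congruent_comp_equiv (κ : 𝔤 →ₗ⁅ℂ⁆ so B) (σ : 𝔤 ≃ₗ⁅ℂ⁆ 𝔤) :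
    Congruent κ (κ.comp (σ : 𝔤 →ₗ⁅ℂ⁆ 𝔤)) :=
  ⟨σ, LinearEquiv.refl ℂ V, fun _ _ ↦ rfl, fun _ _ ↦ rfl⟩

/-- As `σ` acts on `𝔱` by `τ`, the weights of `κ ∘ σ` are those of `κ` composed with `τ`, and the
simple roots of `b₀` pull back to simple roots of `b`. -/
theorem IsHighestWeight.comp_equiv {b b₀ : (rootSys 𝔱).Base} {l : Dual ℂ 𝔱}
    (hl : IsHighestWeight κ b₀ l) (σ : 𝔤 ≃ₗ⁅ℂ⁆ 𝔤) (τ : 𝔱 ≃ₗ[ℂ] 𝔱)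
    (hτ : ∀ t : 𝔱, σ (t : 𝔤) = (τ t : 𝔤))
    (hroot : ∀ j ∈ b₀.support,
      (rootSys 𝔱).root j ∘ₗ τ.toLinearMap ∈ (rootSys 𝔱).root '' b.support) :
    IsHighestWeight (κ.comp (σ : 𝔤 →ₗ⁅ℂ⁆ 𝔤)) b (l ∘ₗ τ.toLinearMap) := by
  have happ : ∀ t : 𝔱, (κ.comp (σ : 𝔤 →ₗ⁅ℂ⁆ 𝔤)) t = κ (τ t : 𝔤) := by
    intro t
    rw [← hτ]
    rfl
  obtain ⟨⟨v, hv0, hv⟩, h⟩ := hl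
  refine ⟨⟨v, hv0, fun t ↦ ?_⟩, ?_⟩
  · rw [happ, hv]
    rfl
  · rintro μ ⟨u, hu0, hu⟩
    have h1 := h (μ ∘ₗ τ.symm.toLinearMap) ⟨u, hu0, fun t ↦ by
      have := hu (τ.symm t)
      rw [happ, LinearEquiv.apply_symm_apply] at this
      exact this⟩
    have h2 : ∀ y ∈ AddSubmonoid.closure ((rootSys 𝔱).root '' b₀.support),
        y ∘ₗ τ.toLinearMap ∈ AddSubmonoid.closure ((rootSys 𝔱).root '' b.support) := by
      intro y hy
      induction hy using AddSubmonoid.closure_induction with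
      | mem y hy =>
        obtain ⟨j, hj, rfl⟩ := hy
        exact AddSubmonoid.subset_closure (hroot j hj)
      | zero => simp
      | add y y' _ _ h h' =>
        rw [LinearMap.add_comp]
        exact add_mem h h'
    have h3 := h2 _ h1
    convert h3 using 1
    ext t
    simp

/-- Bases with the same Cartan matrix are related by an automorphism preserving `𝔱`. -/
theorem exists_equiv_of_cartanMatrix_eq [LieAlgebra.IsSimple ℂ 𝔤] (b b₀ : (rootSys 𝔱).Base)
    (E : b.support ≃ b₀.support)
    (hE : ∀ i j, b.cartanMatrix i j = b₀.cartanMatrix (E i) (E j)) :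
    ∃ (σ : 𝔤 ≃ₗ⁅ℂ⁆ 𝔤) (τ : 𝔱 ≃ₗ[ℂ] 𝔱), (∀ t : 𝔱, σ (t : 𝔤) = (τ t : 𝔤)) ∧
      (∀ i : b.support, τ ((rootSys 𝔱).coroot i) = (rootSys 𝔱).coroot (E i)) ∧
      ∀ j ∈ b₀.support,
        (rootSys 𝔱).root j ∘ₗ τ.toLinearMap ∈ (rootSys 𝔱).root '' b.support := by
  obtain ⟨σ, hσ⟩ := LieAlgebra.IsKilling.exists_equiv_apply_coroot_eq b b₀ E hE
  let τ : 𝔱 ≃ₗ[ℂ] 𝔱 := b.toCoweightBasis.equiv b₀.toCoweightBasis E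
  have hτ : ∀ i : b.support, τ ((rootSys 𝔱).coroot i) = (rootSys 𝔱).coroot (E i) := by
    intro i
    rw [← b.toCoweightBasis_apply, Basis.equiv_apply, b₀.toCoweightBasis_apply]
  refine ⟨σ, τ, fun t ↦ ?_, hτ, fun j hj ↦ ?_⟩
  · have : (σ : 𝔤 →ₗ[ℂ] 𝔤) ∘ₗ 𝔱.toSubmodule.subtype =
        𝔱.toSubmodule.subtype ∘ₗ τ.toLinearMap := by
      refine b.toCoweightBasis.ext fun i ↦ ?_
      rw [b.toCoweightBasis_apply]
      change σ _ = ((τ _ : 𝔱) : 𝔤)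
      rw [hτ]
      exact hσ i
    exact LinearMap.congr_fun this t
  -- The pulled-back root and the simple root of `b` are compared on simple coroots, where their
  -- values are the matching Cartan entries.
  · refine ⟨E.symm ⟨j, hj⟩, (E.symm ⟨j, hj⟩).2, ?_⟩
    refine b.toCoweightBasis.ext fun i ↦ ?_
    rw [b.toCoweightBasis_apply]
    change _ = (rootSys 𝔱).root j (τ _)
    rw [hτ]
    have h1 := hE (E.symm ⟨j, hj⟩) i
    rw [Equiv.apply_symm_apply] at h1
    have h2 := b.algebraMap_cartanMatrixIn_apply ℤ (E.symm ⟨j, hj⟩) i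
    have h3 := b₀.algebraMap_cartanMatrixIn_apply ℤ ⟨j, hj⟩ (E i)
    exact h2.symm.trans ((congrArg _ h1).trans h3)

end Transport

end OrthRep

theorem mainTheorem8
    {𝔤 : Type*} [LieRing 𝔤] [LieAlgebra ℂ 𝔤] [FiniteDimensional ℂ 𝔤] [LieAlgebra.IsSimple ℂ 𝔤]
    (h_sl2 : ¬ Nonempty (𝔤 ≃ₗ⁅ℂ⁆ LieAlgebra.SpecialLinear.sl (Fin 2) ℂ))
    (𝔱 : LieSubalgebra ℂ 𝔤) [𝔱.IsCartanSubalgebra]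
    {V : Type*} [AddCommGroup V] [Module ℂ V] [FiniteDimensional ℂ V]
    (B : LinearMap.BilinForm ℂ V) (hB_symm : B.IsSymm) (hB_nondeg : B.Nondegenerate)
    (κ : 𝔤 →ₗ⁅ℂ⁆ OrthRep.so B)
    (h_irr : OrthRep.IsIrreducible κ) (h_real : OrthRep.IsOfRealType κ)
    (Λ : Module.Dual ℂ 𝔱) (U : AffineSubspace ℂ (Module.Dual ℂ 𝔱))
    (h_planar : OrthRep.IsPlanarSpanningTriple κ Λ (-Λ) U)
    (h_root : ¬ ∃ α ∈ OrthRep.roots 𝔱, ∃ a : ℂ, Λ = a • α) :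
    ∃ (n : ℕ) (hn : 3 ≤ n),
      (∃ (b : (OrthRep.rootSys 𝔱).Base) (e : Fin n ≃ b.support), OrthRep.IsNumberingD b n e) ∧
      ∀ (b : (OrthRep.rootSys 𝔱).Base) (e : Fin n ≃ b.support), OrthRep.IsNumberingD b n e →
        ∃ κ' : 𝔤 →ₗ⁅ℂ⁆ OrthRep.so B,
          OrthRep.IsIrreducible κ' ∧ OrthRep.Congruent κ κ' ∧
          ∃ ω₁ : Module.Dual ℂ 𝔱,
            OrthRep.IsFundamentalWeight b e ⟨0, by omega⟩ ω₁ ∧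
            (OrthRep.IsHighestWeight κ' b ω₁ ∨ OrthRep.IsHighestWeight κ' b ((2 : ℂ) • ω₁)) := by
  have hv : ∀ (i : 𝔱.root) (t : ℂ), Λ ≠ t • (OrthRep.rootSys 𝔱).root i :=
    fun i t h ↦ h_root ⟨_, ⟨i, rfl⟩, t, h⟩
  obtain ⟨b₀, l, hl, w, hw⟩ := h_planar.extremal_left
  obtain ⟨x, hx, hxU⟩ := RootPairing.exists_dual_of_signedOrbit_subset hv
    h_planar.hyperplane.2.1 fun a ha ↦ h_planar.extremal_mem a
      (.of_mem_signedOrbit h_planar.extremal_left h_planar.extremal_right ha)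
  have hx0 : ∀ a ∈ RootPairing.SignedOrbit (OrthRep.rootSys 𝔱) Λ, a ≠ Λ → a ≠ -Λ → x a = 0 :=
    fun a ha h1 h2 ↦ hxU a (h_planar.extremal_mem a
      (.of_mem_signedOrbit h_planar.extremal_left h_planar.extremal_right ha) h1 h2)
  obtain ⟨n, E, k, hn, hk, hE, hlE⟩ := RootPairing.exists_numbering_typeD b₀ (l := l)
    (Ω := OrthRep.weights κ 𝔱) hv hx hx0 (hw ▸ OrthRep.mem_signedOrbit_of_smul w)
    (fun i hi ↦ (OrthRep.exists_nat_of_isHighestWeight hl hi).imp fun m hm ↦ hm.1)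
    (fun i m hm hm0 j hj ↦ OrthRep.coroot_apply_eq_natCast hl i hm hm0 hj) (by
      intro ν hν
      have key : ∀ (ε : ℂ) (β : Dual ℂ 𝔱), β ∈ OrthRep.rootsZero 𝔱 →
          ε • Λ + β = ε • Λ ∨ ∃ i, ε • Λ + β = ε • Λ + (OrthRep.rootSys 𝔱).root i := by
        rintro ε β (⟨i, rfl⟩ | rfl)
        · exact Or.inr ⟨i, rfl⟩
        · exact Or.inl (add_zero _)
      rcases h_planar.weights_subset hν with (⟨β, hβ, rfl⟩ | h) | ⟨β, hβ, rfl⟩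
      · exact Or.inr ⟨1, Or.inl rfl, by simpa using key 1 β hβ⟩
      · exact Or.inl (hxU ν h)
      · exact Or.inr ⟨-1, Or.inr rfl, by simpa using key (-1) β hβ⟩)
  refine ⟨n, hn, ⟨b₀, E, hE⟩, fun b e he ↦ ?_⟩
  obtain ⟨σ, τ, hστ, hτ, hroot⟩ := OrthRep.exists_equiv_of_cartanMatrix_eq b b₀ (e.symm.trans E)
    fun i j ↦ by
      have h1 := he (e.symm i) (e.symm j)
      rw [Equiv.apply_symm_apply, Equiv.apply_symm_apply] at h1
      rw [h1]
      exact (hE _ _).symm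
  have hk0 : k ≠ 0 := by rcases hk with rfl | rfl <;> norm_num
  have hhw := hl.comp_equiv σ τ hστ hroot
  -- The transported highest weight is $k$ at the first simple coroot and $0$ at the others, so
  -- dividing by $k$ gives $\omega_1$.
  refine ⟨κ.comp (σ : 𝔤 →ₗ⁅ℂ⁆ 𝔤), h_irr.comp_equiv σ, OrthRep.congruent_comp_equiv κ σ,
    k⁻¹ • (l ∘ₗ τ.toLinearMap), fun j ↦ ?_, ?_⟩
  · have h1 : l ((OrthRep.rootSys 𝔱).coroot (E j)) = _ := hlE j
    rw [LinearMap.smul_apply, LinearMap.comp_apply, LinearEquiv.coe_coe, hτ, Equiv.trans_apply,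
      Equiv.symm_apply_apply, h1]
    simp only [Fin.ext_iff]
    split_ifs <;> simp [hk0]
  · rcases hk with rfl | rfl
    · left
      rwa [inv_one, one_smul]
    · right
      rwa [smul_smul, mul_inv_cancel₀ two_ne_zero, one_smul]
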